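/- **Proposition 4.2.** *Model.* At times $t=1,\dots,T$ ($T\ge 1$), each large trader $k$ in a finite set submits an order $q^k_t\in\mathbb R$. With $\Sigma_t=\sum_k q^k_t$, the wealths $W^k_t$, market price $P_t$, remaining volumes $\overline Q^k_t$, residual price impact $R_t$ and environment $\mathcal I_t$ evolve by $$W^k_{t+1}=W^k_t-(P_t+\lambda\Sigma_t)q^k_t,\qquad \overline Q^k_{t+1}=\overline Q^k_t-q^k_t,\qquad R_{t+1}=e^{-\rho}(R_t+\alpha\lambda\Sigma_t),$$ $$P_{t+1}=P_t-(1-e^{-\rho})R_t+(\alpha e^{-\rho}+\beta)\lambda\Sigma_t+\mathcal I_t+\epsilon_t,\qquad \mathcal I_t=a_t-b_t\mathcal I_{t-1}+\sigma^{\mathcal I}_t\omega_t,$$ where $\lambda>0$, $\alpha,\beta\in[0,1]$, $\rho\ge 0$, $\alpha e^{-\rho}+\beta<1$, and $a_t,b_t\in\mathbb R$, $\sigma^{\mathcal I}_t\ge 0$. The pairs $(\omega_t,\epsilon_t)$ are independent over $t$ and centred bivariate normal with variances $1$ and $(\sigma^\epsilon_t)^2>0$ and correlation $\rho^{\mathcal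 I,\epsilon}\in(-1,1)$. The state is $s_t=((W^k_t)_k,P_t,(\overline Q^k_t)_k,R_t,\mathcal I_{t-1})$. A Markov strategy $\pi^k$ is a sequence of Borel decision rules $q^k_t=f^k_t(s_t)$, $t=1,\dots,T$. Given strategies $\pi$, the value $V^k_t(\pi)[s]$ of trader $k$ with risk aversion $\gamma^k>0$ is the expectation, given $s_t=s$, of the payoff $-\exp(-\gamma^kW^k_{T+1})$ if $\overline Q^k_{T+1}=0$ and $-\infty$ otherwise. A *Markov perfect equilibrium* of two traders is a pair of Markov strategies such that, for every $t\in\{1,\dots,T\}$ and every state $s$, neither trader $k$ can increase $V^k_t[s]$ by changing his or her own Markov strategy. An *optimal execution strategy* of a trader is a Markov strategy that maximizes $V_t[s]$ for every $t\in\{1,\dots,T\}$ and every $s$ in the same market with that trader as the only large trader. *Statement.* Fix the market, two traders $i\ne j$, and $\gamma^i>0$. Then trader $i$ has an optimal execution strategy in the single-trader market, and for all sufficiently large $\gamma^j$ the two-trader game has a Markov perfect equilibrium. Moreover, let $\pi^*=(f^*_t)_t$ be any optimal execution strategy of trader $i$ and, for all sufficiently large $\gamma^j$, let $\pi^{\gamma^j}$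 be any Markov perfect equilibrium, with trader $i$'s rules $f^{i,\gamma^j}_t$. Then, as $\gamma^j\to\infty$, for every $t\in\{1,\dots,T\}$: 1. if both markets start at time $1$ with $R_1=0$, $\mathcal I_0=0$, the same initial price, and the same arbitrary initial wealth and initial volume $\mathfrak Q^i$ of trader $i$, and trader $j$ has initial volume $\mathfrak Q^j=0$ (and arbitrary initial wealth), then along every realization of the noise the volume executed by trader $i$ at time $t$ in equilibrium converges to the volume executed at time $t$ by the single trader using $\pi^*$; 2. at every state $s$ with $\overline Q^j=0$, $f^{i,\gamma^j}_t(s)$ converges to $f^*_t$ evaluated at the state obtained from $s$ by dropping trader $j$'s wealth and remaining volume. -/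

import Mathlib

open MeasureTheory ProbabilityTheory Filter Topology
open scoped ENNReal

noncomputable section

namespace ExecutionGame

/-- The market parameters: `T` trading times `1, …, T`; time-homogeneous instantaneous price impact
`lam`, temporary and permanent impact coefficients `alpha`, `beta`, and resilience speed `rho`;
the (possibly time-dependent) coefficients of the Markovian environment
`I_t = aI t - bI t * I_{t-1} + sigI t * ω_t`; the standard deviation `sigE t` of the public news
`ε_t`; and the correlation `corr` of `ω_t` and `ε_t`. -/
structure Market where
  T : ℕ
  lam : ℝ
  alpha : ℝ
  beta : ℝ
  rho : ℝ
  aI : ℕ → ℝ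
  bI : ℕ → ℝ
  sigI : ℕ → ℝ
  sigE : ℕ → ℝ
  corr : ℝ
  one_le_T : 1 ≤ T
  lam_pos : 0 < lam
  alpha_mem : alpha ∈ Set.Icc (0 : ℝ) 1
  beta_mem : beta ∈ Set.Icc (0 : ℝ) 1
  rho_nonneg : 0 ≤ rho
  impact_lt_one : alpha * Real.exp (-rho) + beta < 1
  sigI_nonneg : ∀ t ∈ Set.Icc 1 T, 0 ≤ sigI t
  sigE_pos : ∀ t ∈ Set.Icc 1 T, 0 < sigE t
  corr_mem : corr ∈ Set.Ioo (-1 : ℝ) 1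

/-- The centred bivariate normal law of `(ω_t, ε_t)` with variances `1` and `sE ^ 2` and
correlation `c`, as the image of two independent standard normal variables. -/
def noiseLaw (c sE : ℝ) : Measure (ℝ × ℝ) :=
  ((gaussianReal 0 1).prod (gaussianReal 0 1)).map
    (fun z => (z.1, sE * (c * z.1 + Real.sqrt (1 - c ^ 2) * z.2)))

/-- `ξ t = (ω_t, ε_t)`, `t = 1, …, T`, is the noise that drives the market: independent in time,
with the bivariate normal laws of the market `M`. -/
structure IsMarketNoise {Ω : Type*} [MeasurableSpace Ω] (M : Market) (P : Measure Ω)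
    (ξ : ℕ → Ω → ℝ × ℝ) : Prop where
  measurable : ∀ t ∈ Set.Icc 1 M.T, Measurable (ξ t)
  law : ∀ t ∈ Set.Icc 1 M.T, P.map (ξ t) = noiseLaw M.corr (M.sigE t)
  indep : iIndepFun (fun t : Set.Icc 1 M.T => ξ t) P

/-- The state `(W_t, P_t, Q_t, R_t, I_{t-1})` for a finite set `ι` of large traders: wealths, market
price, remaining execution volumes, residual effect of past price impacts, and the previous value of
the environment. The game has `ι = Fin 2`; a single large trader is `ι = Unit`. -/
abbrev State (ι : Type) : Type := (ι → ℝ) × ℝ × (ι → ℝ) × ℝ × ℝ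

namespace State
variable {ι : Type}
/-- Wealth of each trader. -/
abbrev wealth (s : State ι) : ι → ℝ := s.1
/-- Market price. -/
abbrev price (s : State ι) : ℝ := s.2.1
/-- Remaining execution volume of each trader. -/
abbrev remaining (s : State ι) : ι → ℝ := s.2.2.1
/-- Residual effect of past price impacts. -/
abbrev residual (s : State ι) : ℝ := s.2.2.2.1
/-- Previous value of the Markovian environment. -/
abbrev env (s : State ι) : ℝ := s.2.2.2.2
end State

/-- The system dynamics `s_{t+1} = h_t (s_t, q_t, (ω_t, ε_t))`. -/
def step {ι : Type} [Fintype ι] (M : Market) (t : ℕ) (s : State ι) (q : ι → ℝ) (n : ℝ × ℝ) :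
    State ι :=
  let total : ℝ := ∑ k, q k
  let I : ℝ := M.aI t - M.bI t * s.env + M.sigI t * n.1
  (fun k => s.wealth k - (s.price + M.lam * total) * q k,
   s.price - (1 - Real.exp (-M.rho)) * s.residual
     + (M.alpha * Real.exp (-M.rho) + M.beta) * M.lam * total + I + n.2,
   fun k => s.remaining k - q k,
   Real.exp (-M.rho) * (s.residual + M.alpha * M.lam * total),
   I)

/-- Markov execution strategies: a Borel decision rule from states to volumes for each time
(only the rules at times `1, …, T` are ever used). -/
abbrev Strategy (ι : Type) : Type := {f : ℕ → State ι → ℝ // ∀ t, Measurable (f t)}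

/-- The orders submitted at time `t` in state `s` under the strategy profile `π`. -/
def orders {ι : Type} (π : ι → Strategy ι) (t : ℕ) (s : State ι) : ι → ℝ :=
  fun k => (π k).1 t s

/-- The state at time `t + n`, started from `s` at time `t`, under the strategy profile `π`, along
the noise path `x`. -/
def stateFrom {ι : Type} [Fintype ι] (M : Market) (π : ι → Strategy ι) (x : ℕ → ℝ × ℝ)
    (t : ℕ) (s : State ι) : ℕ → State ι
  | 0 => s
  | n + 1 =>
    let s' := stateFrom M π x t s n
    step M (t + n) s' (orders π (t + n) s') (x (t + n))

/-- The terminal utility payoff of trader `k` with risk aversion `γ`: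
exponential utility of wealth, and `-∞` unless all the volume has been executed. -/
def payoff {ι : Type} (γ : ℝ) (k : ι) (s : State ι) : EReal :=
  open Classical in
  if s.remaining k = 0 then ((-Real.exp (-γ * s.wealth k) : ℝ) : EReal) else ⊥

/-- Expectation, with values in `[-∞, 0]`, of a nonpositive extended-real-valued payoff. -/
def expectNonpos {Ω : Type*} [MeasurableSpace Ω] (P : Measure Ω) (g : Ω → EReal) : EReal :=
  -((∫⁻ a, (-g a).toENNReal ∂P : ℝ≥0∞) : EReal)

/-- `V^k_t(π)[s]`, the expected payoff of trader `k` with risk aversion `γ` when the state at time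
`t` is `s`. It uses the strategies in `π` only from time `t` on. -/
def value {ι : Type} [Fintype ι] {Ω : Type*} [MeasurableSpace Ω] (M : Market) (P : Measure Ω)
    (ξ : ℕ → Ω → ℝ × ℝ) (γ : ℝ) (k : ι) (π : ι → Strategy ι) (t : ℕ) (s : State ι) : EReal :=
  expectNonpos P
    (fun a => payoff γ k (stateFrom M π (fun u => ξ u a) t s (M.T + 1 - t)))

/-- Markov perfect equilibrium of the two traders with risk aversions `γ 0`, `γ 1`. -/
def IsMarkovPerfectEquilibrium {Ω : Type*} [MeasurableSpace Ω] (M : Market) (P : Measure Ω)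
    (ξ : ℕ → Ω → ℝ × ℝ) (γ : Fin 2 → ℝ) (π : Fin 2 → Strategy (Fin 2)) : Prop :=
  ∀ (k : Fin 2), ∀ t ∈ Set.Icc 1 M.T, ∀ (s : State (Fin 2)) (σ : Strategy (Fin 2)),
    value M P ξ (γ k) k (Function.update π k σ) t s ≤ value M P ξ (γ k) k π t s

/-- `π` is an optimal execution strategy of a trader with risk aversion `γ` who is the only large
trader in the market: it maximizes the expected payoff at every time and from every state. -/
def IsOptimalExecution {Ω : Type*} [MeasurableSpace Ω] (M : Market) (P : Measure Ω)
    (ξ : ℕ → Ω → ℝ × ℝ) (γ : ℝ) (π : Strategy Unit) : Prop :=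
  ∀ t ∈ Set.Icc 1 M.T, ∀ (s : State Unit) (σ : Strategy Unit),
    value M P ξ γ () (fun _ => σ) t s ≤ value M P ξ γ () (fun _ => π) t s

/-- The initial state at time `1`: no residual price impact and `I_0 = 0`. -/
def initialState {ι : Type} (W : ι → ℝ) (p : ℝ) (Q : ι → ℝ) : State ι := (W, p, Q, 0, 0)

/-- The volumes executed at time `t ≥ 1` when the market starts at time `1` in state `s`. -/
def executed {ι : Type} [Fintype ι] (M : Market) (π : ι → Strategy ι) (x : ℕ → ℝ × ℝ)
    (s : State ι) (t : ℕ) : ι → ℝ :=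
  orders π t (stateFrom M π x 1 s (t - 1))

/-- The state as it appears to trader `i` alone, the other traders being ignored. -/
def State.alone {ι : Type} (i : ι) (s : State ι) : State Unit :=
  (fun _ => s.wealth i, s.price, fun _ => s.remaining i, s.residual, s.env)

end ExecutionGame

end

/-! Exponential utility, Gaussian noise and linear dynamics make the problem linear-quadratic. The
expected loss of a trader is the exponential of `-γ * (W - P * Q)` plus a quadratic form in the
remaining volumes, the residual impact, the environment and a constant coordinate `1`; the constant
coordinate makes affine rules linear and affine-quadratic exponents homogeneous. The Markov property
`cost_step` and the one-shot deviation principle reduce equilibria and optimal strategies to a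
static quadratic game at each time and state.

The limit of infinite risk aversion becomes regular after a rescaling. Put `δ = 1 / γ^j` and let
trader `j` order `Q_j - δ * u`, leaving the volume `δ * u`. The exponent of trader `j` has the form
`-δ⁻¹ * Q_j * N - K` with `N` linear and `K` quadratic. At the next time `Q_j` is `δ * u`, so the
singular factor cancels, and what is singular at the current time does not depend on `u`. In the
variables `(q, u)` the stage game therefore has coefficients continuous at `δ = 0`.

At `δ = 0` trader `j` liquidates at once, whatever `u` is. The first-order condition of trader `i`
is then free of `u`, and the determinant of the two conditions is a product of two curvatures, both
positive. The curvature of trader `i` comes from price impact, that of trader `j` from the variance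
of the public news. By continuity the stage game has exactly one equilibrium for all small `δ`,
given by Cramer's rule and continuous at `δ = 0` (`Coeffs.Regular.eventually_stage`). Three
one-sided bounds on `J` and `K` at `δ = 0` propagate backwards (`Coeffs.Regular.prev`); they keep
the Gaussian moments finite and the curvature of trader `i` positive.

Uniqueness at every stage forces every equilibrium and every single-trader optimum to follow these
coefficients. When `Q_j = 0` the single-trader rule is the rule of trader `i` at `δ = 0`, so the
decision rules converge; convergence of the executed volumes follows by induction along a fixed
noise path. -/

noncomputable section

namespace ExecutionGame

/-! ### Linear and quadratic forms depending continuously on a parameter at `0`. -/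

section Families

variable {ι κ : Type*} [Fintype ι] [Fintype κ]

/-- A family of linear forms on `ι → ℝ` whose coefficients are continuous at the parameter `0`. -/
def LinFam (l : ℝ → (ι → ℝ) → ℝ) : Prop :=
  ∃ c : ι → ℝ → ℝ, (∀ i, ContinuousAt (c i) 0) ∧ ∀ δ v, l δ v = ∑ i, c i δ * v i

/-- A family of quadratic forms on `ι → ℝ` whose coefficients are continuous at the parameter
`0`. -/
def QuadFam (F : ℝ → (ι → ℝ) → ℝ) : Prop :=
  ∃ A : ι → ι → ℝ → ℝ, (∀ i j, ContinuousAt (A i j) 0) ∧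
    ∀ δ v, F δ v = ∑ i, ∑ j, A i j δ * (v i * v j)

/-- The polar form of `F`. -/
def pol (F : (ι → ℝ) → ℝ) (v w : ι → ℝ) : ℝ := F (v + w) - F v - F w

namespace LinFam

variable {l m : ℝ → (ι → ℝ) → ℝ}

theorem coord (i : ι) : LinFam (fun _ (v : ι → ℝ) => v i) := by
  classical
  exact ⟨fun k _ => if k = i then 1 else 0, fun _ => continuousAt_const, fun δ v => by simp⟩

theorem zero : LinFam (fun _ (_ : ι → ℝ) => 0) :=
  ⟨fun _ _ => 0, fun _ => continuousAt_const, fun δ v => by simp⟩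

theorem add (hl : LinFam l) (hm : LinFam m) : LinFam (fun δ v => l δ v + m δ v) := by
  obtain ⟨c, hc, h⟩ := hl
  obtain ⟨d, hd, h'⟩ := hm
  refine ⟨fun i δ => c i δ + d i δ, fun i => (hc i).add (hd i), fun δ v => ?_⟩
  simp only [h, h', add_mul, Finset.sum_add_distrib]

theorem smul (hl : LinFam l) {a : ℝ → ℝ} (ha : ContinuousAt a 0) :
    LinFam (fun δ v => a δ * l δ v) := by
  obtain ⟨c, hc, h⟩ := hl
  refine ⟨fun i δ => a δ * c i δ, fun i => ha.mul (hc i), fun δ v => ?_⟩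
  simp only [h, Finset.mul_sum, mul_assoc]

theorem const_smul (hl : LinFam l) (a : ℝ) : LinFam (fun δ v => a * l δ v) :=
  hl.smul (a := fun _ => a) continuousAt_const

theorem neg (hl : LinFam l) : LinFam (fun δ v => -l δ v) := by
  simpa using hl.const_smul (-1)

theorem sub (hl : LinFam l) (hm : LinFam m) : LinFam (fun δ v => l δ v - m δ v) := by
  simpa [sub_eq_add_neg] using hl.add hm.neg

theorem sum {α : Type*} (s : Finset α) {f : α → ℝ → (ι → ℝ) → ℝ} (hf : ∀ i, LinFam (f i)) :
    LinFam (fun δ v => ∑ i ∈ s, f i δ v) := by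
  classical
  induction s using Finset.induction_on with
  | empty => simpa using zero
  | insert a s ha ih => simpa [Finset.sum_insert ha] using (hf a).add ih

theorem comp (hl : LinFam l) {Y : ℝ → (κ → ℝ) → ι → ℝ}
    (hY : ∀ i, LinFam (fun δ v => Y δ v i)) : LinFam (fun δ v => l δ (Y δ v)) := by
  obtain ⟨c, hc, h⟩ := hl
  simp only [h]
  exact sum _ fun i => (hY i).smul (hc i)

theorem map_add (hl : LinFam l) (δ : ℝ) (v w : ι → ℝ) : l δ (v + w) = l δ v + l δ w := by
  obtain ⟨c, -, h⟩ := hl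
  simp [h, mul_add, Finset.sum_add_distrib]

theorem map_smul (hl : LinFam l) (δ a : ℝ) (v : ι → ℝ) : l δ (a • v) = a * l δ v := by
  obtain ⟨c, -, h⟩ := hl
  simp only [h, Finset.mul_sum, Pi.smul_apply, smul_eq_mul]
  exact Finset.sum_congr rfl fun i _ => by ring

theorem tendsto (hl : LinFam l) {α : Type*} {f : Filter α} {d : α → ℝ} {v : α → ι → ℝ}
    {v₀ : ι → ℝ} (hd : Tendsto d f (𝓝 0)) (hv : Tendsto v f (𝓝 v₀)) :
    Tendsto (fun a => l (d a) (v a)) f (𝓝 (l 0 v₀)) := by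
  obtain ⟨c, hc, h⟩ := hl
  simp only [h]
  refine tendsto_finsetSum _ fun i _ => ((hc i).tendsto.comp hd).mul ?_
  exact (continuous_apply i).continuousAt.tendsto.comp hv

theorem continuousAt (hl : LinFam l) (v : ι → ℝ) : ContinuousAt (fun δ => l δ v) 0 :=
  hl.tendsto tendsto_id tendsto_const_nhds

theorem continuous (hl : LinFam l) (δ : ℝ) : Continuous (l δ) := by
  obtain ⟨c, -, h⟩ := hl
  have : l δ = fun v => ∑ i, c i δ * v i := funext (h δ)
  rw [this]
  fun_prop

end LinFam

namespace QuadFam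

variable {F G : ℝ → (ι → ℝ) → ℝ}

theorem zero : QuadFam (fun _ (_ : ι → ℝ) => 0) :=
  ⟨fun _ _ _ => 0, fun _ _ => continuousAt_const, fun δ v => by simp⟩

theorem add (hF : QuadFam F) (hG : QuadFam G) : QuadFam (fun δ v => F δ v + G δ v) := by
  obtain ⟨c, hc, h⟩ := hF
  obtain ⟨d, hd, h'⟩ := hG
  refine ⟨fun i j δ => c i j δ + d i j δ, fun i j => (hc i j).add (hd i j), fun δ v => ?_⟩
  simp only [h, h', add_mul, Finset.sum_add_distrib]

theorem smul (hF : QuadFam F) {a : ℝ → ℝ} (ha : ContinuousAt a 0) :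
    QuadFam (fun δ v => a δ * F δ v) := by
  obtain ⟨c, hc, h⟩ := hF
  refine ⟨fun i j δ => a δ * c i j δ, fun i j => ha.mul (hc i j), fun δ v => ?_⟩
  simp only [h, Finset.mul_sum, mul_assoc]

theorem const_smul (hF : QuadFam F) (a : ℝ) : QuadFam (fun δ v => a * F δ v) :=
  hF.smul (a := fun _ => a) continuousAt_const

theorem neg (hF : QuadFam F) : QuadFam (fun δ v => -F δ v) := by
  simpa using hF.const_smul (-1)

theorem sub (hF : QuadFam F) (hG : QuadFam G) : QuadFam (fun δ v => F δ v - G δ v) := by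
  simpa [sub_eq_add_neg] using hF.add hG.neg

theorem sum {α : Type*} (s : Finset α) {f : α → ℝ → (ι → ℝ) → ℝ} (hf : ∀ i, QuadFam (f i)) :
    QuadFam (fun δ v => ∑ i ∈ s, f i δ v) := by
  classical
  induction s using Finset.induction_on with
  | empty => simpa using zero
  | insert a s ha ih => simpa [Finset.sum_insert ha] using (hf a).add ih

theorem mul {l m : ℝ → (ι → ℝ) → ℝ} (hl : LinFam l) (hm : LinFam m) :
    QuadFam (fun δ v => l δ v * m δ v) := by
  obtain ⟨c, hc, h⟩ := hl
  obtain ⟨d, hd, h'⟩ := hm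
  refine ⟨fun i j δ => c i δ * d j δ, fun i j => (hc i).mul (hd j), fun δ v => ?_⟩
  simp only [h, h', Finset.sum_mul_sum]
  exact Finset.sum_congr rfl fun i _ => Finset.sum_congr rfl fun j _ => by ring

theorem sq {l : ℝ → (ι → ℝ) → ℝ} (hl : LinFam l) : QuadFam (fun δ v => l δ v ^ 2) := by
  simpa only [pow_two] using mul hl hl

theorem comp (hF : QuadFam F) {Y : ℝ → (κ → ℝ) → ι → ℝ}
    (hY : ∀ i, LinFam (fun δ v => Y δ v i)) : QuadFam (fun δ v => F δ (Y δ v)) := by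
  obtain ⟨c, hc, h⟩ := hF
  simp only [h]
  exact sum _ fun i => sum _ fun j => (mul (hY i) (hY j)).smul (hc i j)

theorem pol (hF : QuadFam F) (w : ι → ℝ) : LinFam (fun δ v => pol (F δ) v w) := by
  obtain ⟨A, hA, h⟩ := hF
  have : (fun δ v => ExecutionGame.pol (F δ) v w)
      = fun δ v => ∑ i, ∑ j, ((A i j δ * w j) * v i + (A i j δ * w i) * v j) := by
    funext δ v
    simp only [ExecutionGame.pol, h, ← Finset.sum_sub_distrib, Pi.add_apply]
    exact Finset.sum_congr rfl fun i _ => Finset.sum_congr rfl fun j _ => by ring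
  rw [this]
  exact LinFam.sum _ fun i => LinFam.sum _ fun j =>
    ((LinFam.coord i).smul ((hA i j).mul continuousAt_const)).add
      ((LinFam.coord j).smul ((hA i j).mul continuousAt_const))

theorem map_smul (hF : QuadFam F) (δ a : ℝ) (v : ι → ℝ) : F δ (a • v) = a ^ 2 * F δ v := by
  obtain ⟨A, -, h⟩ := hF
  simp only [h, Finset.mul_sum, Pi.smul_apply, smul_eq_mul]
  exact Finset.sum_congr rfl fun i _ => Finset.sum_congr rfl fun j _ => by ring

theorem map_zero (hF : QuadFam F) (δ : ℝ) : F δ 0 = 0 := by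
  simpa using hF.map_smul δ 0 0

theorem map_add_smul (hF : QuadFam F) (δ a : ℝ) (v w : ι → ℝ) :
    F δ (v + a • w) = F δ v + a * ExecutionGame.pol (F δ) v w + a ^ 2 * F δ w := by
  obtain ⟨A, -, h⟩ := hF
  simp only [ExecutionGame.pol, h, Finset.mul_sum, ← Finset.sum_sub_distrib,
    ← Finset.sum_add_distrib, Pi.add_apply, Pi.smul_apply, smul_eq_mul]
  exact Finset.sum_congr rfl fun i _ => Finset.sum_congr rfl fun j _ => by ring

theorem pol_self (hF : QuadFam F) (δ : ℝ) (v : ι → ℝ) :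
    ExecutionGame.pol (F δ) v v = 2 * F δ v := by
  have := hF.map_smul δ 2 v
  rw [two_smul] at this
  rw [ExecutionGame.pol, this]
  ring

theorem continuousAt (hF : QuadFam F) (v : ι → ℝ) : ContinuousAt (fun δ => F δ v) 0 := by
  obtain ⟨A, hA, h⟩ := hF
  simp only [h]
  exact tendsto_finsetSum _ fun i _ => tendsto_finsetSum _ fun j _ =>
    ((hA i j).mul continuousAt_const).tendsto

end QuadFam

/-- A quadratic form that is strictly convex in the direction `e` is minimal along the line
`v + ℝ e` exactly at the critical points. -/
theorem QuadFam.isMin_iff {F : ℝ → (ι → ℝ) → ℝ} (hF : QuadFam F) (δ : ℝ) {e : ι → ℝ}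
    (he : 0 < F δ e) (v : ι → ℝ) :
    (∀ a : ℝ, F δ v ≤ F δ (v + a • e)) ↔ ExecutionGame.pol (F δ) v e = 0 := by
  constructor
  · intro h
    by_contra hne
    have h1 := h (-(ExecutionGame.pol (F δ) v e) / (2 * F δ e))
    rw [hF.map_add_smul] at h1
    have h2 : 0 < ExecutionGame.pol (F δ) v e ^ 2 / (4 * F δ e) := by positivity
    have h3 : -(ExecutionGame.pol (F δ) v e) / (2 * F δ e) * ExecutionGame.pol (F δ) v e
        + (-(ExecutionGame.pol (F δ) v e) / (2 * F δ e)) ^ 2 * F δ e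
        = -(ExecutionGame.pol (F δ) v e ^ 2 / (4 * F δ e)) := by
      field_simp
      ring
    linarith
  · intro h a
    rw [hF.map_add_smul, h]
    nlinarith [mul_nonneg (sq_nonneg a) he.le]

end Families

/-! ### Gaussian exponential moments. -/

theorem lintegral_exp_mul_gaussianReal (v : NNReal) (b : ℝ) :
    ∫⁻ x, ENNReal.ofReal (Real.exp (b * x)) ∂(gaussianReal 0 v)
      = ENNReal.ofReal (Real.exp (v * b ^ 2 / 2)) := by
  rw [← ofReal_integral_eq_lintegral_ofReal (integrable_exp_mul_gaussianReal b)
    (ae_of_all _ fun x => (Real.exp_pos _).le)]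
  have := congrFun (mgf_id_gaussianReal (μ := 0) (v := v)) b
  simp only [mgf, id] at this
  rw [this]
  simp

/-- Multiplying the standard normal density by `exp (c * x ^ 2)` gives a multiple of the centred
normal density with variance `1 / (1 - 2 * c)`, which leaves a linear exponential moment. -/
theorem lintegral_exp_quadratic_gaussianReal (a b c : ℝ) (hc : 0 < 1 - 2 * c) :
    ∫⁻ x, ENNReal.ofReal (Real.exp (a + b * x + c * x ^ 2)) ∂(gaussianReal 0 1)
      = ENNReal.ofReal
          (Real.exp (a + b ^ 2 / (2 * (1 - 2 * c)) - Real.log (1 - 2 * c) / 2)) := by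
  set v : NNReal := ⟨(1 - 2 * c)⁻¹, (inv_pos.2 hc).le⟩ with hv
  have hv' : (v : ℝ) = (1 - 2 * c)⁻¹ := rfl
  have hv0 : v ≠ 0 := by
    rw [Ne, ← NNReal.coe_eq_zero, hv']
    exact (inv_pos.2 hc).ne'
  have hint := lintegral_exp_mul_gaussianReal v b
  rw [gaussianReal_of_var_ne_zero _ hv0, lintegral_withDensity_eq_lintegral_mul _
    (measurable_gaussianPDF _ _) (by fun_prop)] at hint
  rw [gaussianReal_of_var_ne_zero _ one_ne_zero, lintegral_withDensity_eq_lintegral_mul _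
    (measurable_gaussianPDF _ _) (by fun_prop)]
  have key : ∀ x : ℝ, (gaussianPDF 0 1 * fun x => ENNReal.ofReal
        (Real.exp (a + b * x + c * x ^ 2))) x
      = ENNReal.ofReal (Real.exp (a - Real.log (1 - 2 * c) / 2)) *
        (gaussianPDF 0 v * fun x => ENNReal.ofReal (Real.exp (b * x))) x := by
    intro x
    simp only [Pi.mul_apply, gaussianPDF]
    rw [← ENNReal.ofReal_mul (gaussianPDFReal_nonneg _ _ _),
      ← ENNReal.ofReal_mul (gaussianPDFReal_nonneg _ _ _),
      ← ENNReal.ofReal_mul (Real.exp_pos _).le]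
    congr 1
    have hs : Real.exp (-(Real.log (1 - 2 * c) / 2)) = √((1 - 2 * c)⁻¹) := by
      rw [Real.sqrt_eq_rpow, Real.rpow_def_of_pos (inv_pos.2 hc), Real.log_inv]
      congr 1
      ring
    have h1 : (√(2 * Real.pi * (1 - 2 * c)⁻¹))⁻¹ * √((1 - 2 * c)⁻¹) = (√(2 * Real.pi))⁻¹ := by
      rw [Real.sqrt_mul (by positivity)]
      have : √((1 - 2 * c)⁻¹) ≠ 0 := (Real.sqrt_pos.2 (inv_pos.2 hc)).ne'
      field_simp
    simp only [gaussianPDFReal, hv', NNReal.coe_one, mul_one, sub_zero]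
    rw [← h1, sub_eq_add_neg a, Real.exp_add a, hs]
    have h2 : Real.exp (-x ^ 2 / 2) * Real.exp (a + b * x + c * x ^ 2)
        = Real.exp a * (Real.exp (-x ^ 2 / (2 * (1 - 2 * c)⁻¹)) * Real.exp (b * x)) := by
      rw [← Real.exp_add, ← Real.exp_add, ← Real.exp_add]
      congr 1
      field_simp
      ring
    linear_combination ((√(2 * Real.pi * (1 - 2 * c)⁻¹))⁻¹ * √((1 - 2 * c)⁻¹)) * h2
  rw [lintegral_congr key, lintegral_const_mul' _ _ ENNReal.ofReal_ne_top, hint,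
    ← ENNReal.ofReal_mul (Real.exp_pos _).le, ← Real.exp_add, hv']
  congr 2
  field_simp
  ring

instance isProbabilityMeasure_noiseLaw (c s : ℝ) : IsProbabilityMeasure (noiseLaw c s) := by
  unfold noiseLaw
  exact Measure.isProbabilityMeasure_map (by fun_prop)

/-- Exponential moments of the bivariate normal noise. -/
theorem lintegral_exp_noiseLaw {c s : ℝ} (hc : c ∈ Set.Ioo (-1 : ℝ) 1) (a₀ a₁ a₂ d : ℝ)
    (h₂ : 0 < 1 - 2 * a₂) :
    ∫⁻ n, ENNReal.ofReal (Real.exp (a₀ + a₁ * n.1 + a₂ * n.1 ^ 2 + d * n.2)) ∂(noiseLaw c s)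
      = ENNReal.ofReal (Real.exp (a₀ + s ^ 2 * (1 - c ^ 2) * d ^ 2 / 2
          + (a₁ + s * c * d) ^ 2 / (2 * (1 - 2 * a₂)) - Real.log (1 - 2 * a₂) / 2)) := by
  have hc2 : 0 ≤ 1 - c ^ 2 := by nlinarith [hc.1, hc.2]
  rw [noiseLaw, lintegral_map (by fun_prop) (by fun_prop), lintegral_prod _ (by fun_prop)]
  have inner : ∀ x : ℝ, ∫⁻ y, ENNReal.ofReal (Real.exp (a₀ + a₁ * x + a₂ * x ^ 2
        + d * (s * (c * x + √(1 - c ^ 2) * y)))) ∂(gaussianReal 0 1)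
      = ENNReal.ofReal (Real.exp ((a₀ + s ^ 2 * (1 - c ^ 2) * d ^ 2 / 2)
          + (a₁ + s * c * d) * x + a₂ * x ^ 2)) := by
    intro x
    -- Given `ω`, the exponent is affine in the second normal variable, hence the quadratic
    -- coefficient `0`.
    have := lintegral_exp_quadratic_gaussianReal
      (a₀ + (a₁ + s * c * d) * x + a₂ * x ^ 2) (d * s * √(1 - c ^ 2)) 0 (by norm_num)
    convert this using 4
    · ring_nf
    · simp only [mul_pow, Real.sq_sqrt hc2]
      simp
      ring
  simp only [inner]
  exact lintegral_exp_quadratic_gaussianReal _ _ _ h₂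

/-! ### Expected losses, the Markov property and one-shot deviations. -/

section Cost

variable {ι : Type}

open Classical in
/-- The negative of the terminal payoff. -/
def loss (γ : ℝ) (k : ι) (s : State ι) : ℝ≥0∞ :=
  if s.remaining k = 0 then ENNReal.ofReal (Real.exp (-γ * s.wealth k)) else ⊤

theorem toENNReal_neg_payoff (γ : ℝ) (k : ι) (s : State ι) :
    (-payoff γ k s).toENNReal = loss γ k s := by
  unfold payoff loss
  split_ifs
  · rw [← EReal.coe_neg, neg_neg, EReal.toENNReal_of_ne_top (EReal.coe_ne_top _),
      EReal.toReal_coe]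
  · simp

theorem measurable_orders (π : ι → Strategy ι) (t : ℕ) : Measurable (orders π t) :=
  measurable_pi_iff.2 fun k => (π k).2 t

theorem measurable_loss (γ : ℝ) (k : ι) : Measurable (loss γ k) := by
  unfold loss
  refine Measurable.ite ?_ ?_ measurable_const
  · have : Measurable fun s : State ι => s.remaining k := by
      unfold State.remaining; fun_prop
    exact this (measurableSet_singleton 0)
  · unfold State.wealth; fun_prop

theorem orders_update [DecidableEq ι] (π : ι → Strategy ι) (k : ι) (σ : Strategy ι) (t : ℕ) (s : State ι) :
    orders (Function.update π k σ) t s = Function.update (orders π t s) k (σ.1 t s) := by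
  funext l
  by_cases h : l = k
  · subst h; simp [orders]
  · simp [orders, h]

variable [Fintype ι] {Ω : Type*} [MeasurableSpace Ω] {P : Measure Ω} {M : Market}
  {ξ : ℕ → Ω → ℝ × ℝ}

/-- The expected loss of trader `k`, that is, the negative of the value. -/
def cost (M : Market) (P : Measure Ω) (ξ : ℕ → Ω → ℝ × ℝ) (γ : ℝ) (k : ι)
    (π : ι → Strategy ι) (t : ℕ) (s : State ι) : ℝ≥0∞ :=
  ∫⁻ a, loss γ k (stateFrom M π (fun u => ξ u a) t s (M.T + 1 - t)) ∂P

theorem value_eq (γ : ℝ) (k : ι) (π : ι → Strategy ι) (t : ℕ) (s : State ι) :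
    value M P ξ γ k π t s = -((cost M P ξ γ k π t s : ℝ≥0∞) : EReal) := by
  simp only [value, expectNonpos, toENNReal_neg_payoff, cost]

/-- Maximizing the value amounts to minimizing a nonnegative integral, where infinite losses require
no integrability. -/
theorem value_le_value_iff (γ : ℝ) (k : ι) (π σ : ι → Strategy ι) (t : ℕ) (s : State ι) :
    value M P ξ γ k σ t s ≤ value M P ξ γ k π t s
      ↔ cost M P ξ γ k π t s ≤ cost M P ξ γ k σ t s := by
  rw [value_eq, value_eq, EReal.neg_le_neg_iff, EReal.coe_ennreal_le_coe_ennreal_iff]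

theorem stateFrom_succ_left (π : ι → Strategy ι) (x : ℕ → ℝ × ℝ) (t : ℕ) (s : State ι) (n : ℕ) :
    stateFrom M π x t s (n + 1)
      = stateFrom M π x (t + 1) (step M t s (orders π t s) (x t)) n := by
  induction n with
  | zero => rfl
  | succ n ih =>
    rw [stateFrom, ih, stateFrom, Nat.add_right_comm t 1 n]
    rfl

theorem stateFrom_congr {π π' : ι → Strategy ι} {x x' : ℕ → ℝ × ℝ} {t : ℕ} (s : State ι) {n : ℕ}
    (hx : ∀ u, t ≤ u → u < t + n → x u = x' u)
    (hπ : ∀ u, t ≤ u → u < t + n → ∀ s, orders π u s = orders π' u s) :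
    stateFrom M π x t s n = stateFrom M π' x' t s n := by
  induction n with
  | zero => rfl
  | succ n ih =>
    rw [stateFrom, stateFrom, ih (fun u h h' => hx u h (by omega))
      (fun u h h' => hπ u h (by omega)), hx _ (by omega) (by omega), hπ _ (by omega) (by omega)]

theorem measurable_step (M : Market) (t : ℕ) :
    Measurable fun p : State ι × (ι → ℝ) × (ℝ × ℝ) => step M t p.1 p.2.1 p.2.2 := by
  unfold step State.wealth State.price State.remaining State.residual State.env
  fun_prop

theorem measurable_stateFrom (M : Market) (π : ι → Strategy ι) (t n : ℕ) :
    Measurable fun p : State ι × (ℕ → ℝ × ℝ) => stateFrom M π p.2 t p.1 n := by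
  induction n with
  | zero => exact measurable_fst
  | succ n ih =>
    simp only [stateFrom]
    exact (measurable_step M (t + n)).comp
      (ih.prodMk (((measurable_orders π (t + n)).comp ih).prodMk
        ((measurable_pi_apply (t + n)).comp measurable_snd)))

/-- Nothing is assumed about the noise outside `1, …, T`, so the future path is cut off by zeros
there; the states up to time `T + 1` are unaffected. -/
theorem IsMarketNoise.measurable_future (hξ : IsMarketNoise M P ξ) (t : ℕ) :
    Measurable fun (a : Ω) (u : ℕ) => if t < u ∧ u ≤ M.T then ξ u a else 0 := by
  refine measurable_pi_iff.2 fun u => ?_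
  by_cases h : t < u ∧ u ≤ M.T
  · simpa only [h, and_self, if_true] using hξ.measurable u ⟨by omega, h.2⟩
  · simp only [h, if_false, measurable_const]

/-- Joint independence separates the block `{t}` from the block of later times; a projection and an
extension by zero then recover the two variables. -/
theorem IsMarketNoise.indepFun_future (hξ : IsMarketNoise M P ξ) {t : ℕ}
    (ht : t ∈ Set.Icc 1 M.T) :
    IndepFun (ξ t) (fun a u => if t < u ∧ u ≤ M.T then ξ u a else 0) P := by
  classical
  let S : Finset (Set.Icc 1 M.T) := Finset.univ.filter fun u => t < u
  let ψ : (S → ℝ × ℝ) → ℕ → ℝ × ℝ := fun y u =>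
    if hu : t < u ∧ u ≤ M.T then y ⟨⟨u, by omega, hu.2⟩, by simp [S, hu.1]⟩ else 0
  have hψ : Measurable ψ := by
    refine measurable_pi_iff.2 fun u => ?_
    by_cases hu : t < u ∧ u ≤ M.T
    · simp only [ψ, hu, and_self, dif_pos]
      exact measurable_pi_apply (X := fun _ : S => ℝ × ℝ) _
    · simp only [ψ, hu, dif_neg, not_false_eq_true, measurable_const]
  have h := hξ.indep.indepFun_finset {⟨t, ht⟩} S (by simp [S]) (fun u => hξ.measurable u u.2)
  have h' := h.comp (φ := fun y => y ⟨⟨t, ht⟩, by simp⟩)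
    (measurable_pi_apply (X := fun _ => ℝ × ℝ) _) hψ
  have hfut : (fun (a : Ω) (u : ℕ) => if t < u ∧ u ≤ M.T then ξ u a else 0)
      = ψ ∘ fun a (u : S) => ξ u a := by
    funext a u
    by_cases hu : t < u ∧ u ≤ M.T <;> simp [ψ, hu]
  rw [hfut]
  exact h'

theorem cost_eq_future (γ : ℝ) (k : ι) (π : ι → Strategy ι) (t : ℕ) (s : State ι) :
    cost M P ξ γ k π (t + 1) s = ∫⁻ a, loss γ k (stateFrom M π
      (fun u => if t < u ∧ u ≤ M.T then ξ u a else 0) (t + 1) s (M.T - t)) ∂P := by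
  rw [cost, Nat.add_sub_add_right]
  refine lintegral_congr fun a => ?_
  rw [stateFrom_congr s (fun u h h' => ?_) (fun u _ _ _ => rfl)]
  rw [if_pos ⟨by omega, by omega⟩]

theorem cost_terminal [IsProbabilityMeasure P] (γ : ℝ) (k : ι) (π : ι → Strategy ι)
    (s : State ι) : cost M P ξ γ k π (M.T + 1) s = loss γ k s := by
  simp [cost, stateFrom]

/-- The Markov property: the cost at time `t` is the expected cost at time `t + 1`. -/
theorem cost_step [IsProbabilityMeasure P] (hξ : IsMarketNoise M P ξ) (γ : ℝ) (k : ι)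
    (π : ι → Strategy ι) {t : ℕ} (ht : t ∈ Set.Icc 1 M.T) (s : State ι) :
    cost M P ξ γ k π t s = ∫⁻ n, cost M P ξ γ k π (t + 1) (step M t s (orders π t s) n)
      ∂(noiseLaw M.corr (M.sigE t)) := by
  have hF := hξ.measurable_future t
  have hm := hξ.measurable t ht
  have hstep : Measurable fun p : (ℝ × ℝ) × (ℕ → ℝ × ℝ) =>
      loss γ k (stateFrom M π p.2 (t + 1) (step M t s (orders π t s) p.1) (M.T - t)) := by
    refine (measurable_loss γ k).comp ((measurable_stateFrom M π (t + 1) (M.T - t)).comp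
      (Measurable.prodMk ?_ measurable_snd))
    exact (measurable_step M t).comp (measurable_const.prodMk (measurable_const.prodMk
      measurable_fst))
  have hprod := (indepFun_iff_map_prod_eq_prod_map_map hm.aemeasurable hF.aemeasurable).1
    (hξ.indepFun_future ht)
  have h1 : cost M P ξ γ k π t s = ∫⁻ a, loss γ k (stateFrom M π
      (fun u => if t < u ∧ u ≤ M.T then ξ u a else 0) (t + 1)
        (step M t s (orders π t s) (ξ t a)) (M.T - t)) ∂P := by
    rw [cost, show M.T + 1 - t = M.T - t + 1 by have := ht.2; omega]
    refine lintegral_congr fun a => ?_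
    rw [stateFrom_succ_left, stateFrom_congr _ (fun u h h' => ?_) (fun u _ _ _ => rfl)]
    rw [if_pos ⟨by omega, by omega⟩]
  rw [h1, ← hξ.law t ht]
  have h2 := lintegral_map (μ := P) hstep (hm.prodMk hF)
  rw [← h2, hprod]
  have := Measure.isProbabilityMeasure_map (μ := P) hm.aemeasurable
  have := Measure.isProbabilityMeasure_map (μ := P) hF.aemeasurable
  rw [lintegral_prod _ hstep.aemeasurable]
  refine lintegral_congr fun n => ?_
  rw [cost_eq_future]
  exact lintegral_map (hstep.comp (measurable_const.prodMk measurable_id)) hF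

theorem cost_congr {π π' : ι → Strategy ι} (γ : ℝ) (k : ι) {t : ℕ}
    (h : ∀ u, t ≤ u → u ≤ M.T → ∀ s, orders π u s = orders π' u s) (s : State ι) :
    cost M P ξ γ k π t s = cost M P ξ γ k π' t s := by
  refine lintegral_congr fun a => ?_
  rw [stateFrom_congr s (fun _ _ _ => rfl) (fun u hu hu' => h u hu (by omega))]

/-- The expected cost at time `t` if the orders `q` are submitted, followed by `π`. -/
def stageCost (M : Market) (P : Measure Ω) (ξ : ℕ → Ω → ℝ × ℝ) (γ : ℝ) (k : ι)
    (π : ι → Strategy ι) (t : ℕ) (s : State ι) (q : ι → ℝ) : ℝ≥0∞ :=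
  ∫⁻ n, cost M P ξ γ k π (t + 1) (step M t s q n) ∂(noiseLaw M.corr (M.sigE t))

theorem stageCost_congr {π π' : ι → Strategy ι} (γ : ℝ) (k : ι) {t : ℕ}
    (h : ∀ u, t + 1 ≤ u → u ≤ M.T → ∀ s, orders π u s = orders π' u s) (s : State ι)
    (q : ι → ℝ) : stageCost M P ξ γ k π t s q = stageCost M P ξ γ k π' t s q :=
  lintegral_congr fun _ => cost_congr γ k h _

variable [DecidableEq ι]

/-- A profile without profitable deviations has no profitable one-shot deviations. -/
theorem stageCost_le_of_optimal [IsProbabilityMeasure P] (hξ : IsMarketNoise M P ξ) {γ : ℝ}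
    {k : ι} {π : ι → Strategy ι} {t : ℕ} (ht : t ∈ Set.Icc 1 M.T) (s : State ι)
    (h : ∀ σ : Strategy ι,
      cost M P ξ γ k π t s ≤ cost M P ξ γ k (Function.update π k σ) t s) (q : ℝ) :
    stageCost M P ξ γ k π t s (orders π t s)
      ≤ stageCost M P ξ γ k π t s (Function.update (orders π t s) k q) := by
  -- The deviation orders `q` in every state at time `t`, which keeps it Borel; only its value at
  -- `s` matters.
  let σ : Strategy ι := ⟨fun u => if u = t then fun _ => q else (π k).1 u, fun u => by
    dsimp only
    split_ifs
    · exact measurable_const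
    · exact (π k).2 u⟩
  have h1 := h σ
  rw [cost_step hξ _ _ _ ht, cost_step hξ _ _ _ ht, orders_update] at h1
  have h2 : σ.1 t s = q := by simp [σ]
  rw [h2] at h1
  refine h1.trans (stageCost_congr (π := Function.update π k σ) γ k (fun u hu _ s' => ?_) s _).le
  rw [orders_update]
  have : σ.1 u s' = orders π u s' k := by
    simp [σ, orders, show u ≠ t by omega]
  rw [this, Function.update_eq_self]

/-- The one-shot deviation principle. -/
theorem optimal_of_stageCost_le [IsProbabilityMeasure P] (hξ : IsMarketNoise M P ξ) {γ : ℝ}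
    {k : ι} {π : ι → Strategy ι}
    (h : ∀ t ∈ Set.Icc 1 M.T, ∀ (s : State ι) (q : ℝ),
      stageCost M P ξ γ k π t s (orders π t s)
        ≤ stageCost M P ξ γ k π t s (Function.update (orders π t s) k q))
    {t : ℕ} (ht : t ∈ Set.Icc 1 M.T) (s : State ι) (σ : Strategy ι) :
    cost M P ξ γ k π t s ≤ cost M P ξ γ k (Function.update π k σ) t s := by
  suffices H : ∀ n, ∀ t, 1 ≤ t → t + n = M.T + 1 → ∀ s,
      cost M P ξ γ k π t s ≤ cost M P ξ γ k (Function.update π k σ) t s from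
    H (M.T + 1 - t) t ht.1 (by have := ht.2; omega) s
  intro n
  induction n with
  | zero =>
    intro t _ htn s
    obtain rfl : t = M.T + 1 := by omega
    rw [cost_terminal, cost_terminal]
  | succ n ih =>
    intro t ht1 htn s
    have ht' : t ∈ Set.Icc 1 M.T := ⟨ht1, by omega⟩
    rw [cost_step hξ _ _ _ ht', cost_step hξ _ _ _ ht', orders_update]
    -- First the order at time `t` alone is changed, with `π` as continuation; then the continuation
    -- is changed under the integral.
    exact (h t ht' s _).trans (lintegral_mono fun n => ih (t + 1) (by omega) (by omega) _)

end Cost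

/-! ### The rescaled quadratic stage game. -/

section Stage

/-- The direction of the environment in the homogenized coordinates `(Q_i, Q_j, R, I, 1)`. -/
def envDir : Fin 5 → ℝ := ![0, 0, 0, 1, 0]

/-- The deterministic part of the transition of the homogenized coordinates when trader `i` orders
`q` and trader `j` orders `p`. -/
def drift (M : Market) (t : ℕ) (x : Fin 5 → ℝ) (q p : ℝ) : Fin 5 → ℝ :=
  ![x 0 - q, x 1 - p, Real.exp (-M.rho) * (x 2 + M.alpha * M.lam * (q + p)),
    M.aI t * x 4 - M.bI t * x 3, x 4]

/-- The conditional mean of the price increment. -/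
def slip (M : Market) (t : ℕ) (x : Fin 5 → ℝ) (q p : ℝ) : ℝ :=
  (M.alpha * Real.exp (-M.rho) + M.beta) * M.lam * (q + p) - (1 - Real.exp (-M.rho)) * x 2
    + (M.aI t * x 4 - M.bI t * x 3)

/-- The logarithm of the expectation of `exp (J (y + σ ω e) + d (σ ω + ε))`, `e` being the direction
of the environment, made homogeneous in `y`. -/
def logMoment (M : Market) (t : ℕ) (J : (Fin 5 → ℝ) → ℝ) (y : Fin 5 → ℝ) (d : ℝ) : ℝ :=
  J y + M.sigE t ^ 2 * (1 - M.corr ^ 2) * d ^ 2 / 2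
    + (M.sigI t * d + M.sigI t * pol J y envDir + M.sigE t * M.corr * d) ^ 2
      / (2 * (1 - 2 * (M.sigI t ^ 2 * J envDir)))
    - Real.log (1 - 2 * (M.sigI t ^ 2 * J envDir)) / 2 * y 4 ^ 2

/-- The exponent of the expected loss of trader `i` at a stage with continuation exponent `J`. -/
def exponentI (M : Market) (t : ℕ) (γ : ℝ) (J : (Fin 5 → ℝ) → ℝ) (x : Fin 5 → ℝ) (q p : ℝ) : ℝ :=
  γ * (M.lam * (q + p) * q) + slip M t x q p * (γ * (x 0 - q))
    + logMoment M t J (drift M t x q p) (γ * (x 0 - q))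

/-- The regular part of the exponent of the expected loss of trader `j`, whose risk aversion is
`1 / δ` and who leaves the volume `δ * u` to be executed later; the continuation exponent is
`-u * N - K`. -/
def exponentJ (M : Market) (t : ℕ) (δ : ℝ) (N K : (Fin 5 → ℝ) → ℝ) (x : Fin 5 → ℝ) (q u : ℝ) : ℝ :=
  -(M.lam * (q + (x 1 - δ * u)) * u) + slip M t x q (x 1 - δ * u) * u
    - u * N (drift M t x q (x 1 - δ * u)) - K (drift M t x q (x 1 - δ * u))
    + M.sigE t ^ 2 * (1 - M.corr ^ 2) * u ^ 2 / 2
    + (M.sigI t * u - M.sigI t * (u * N envDir + pol K (drift M t x q (x 1 - δ * u)) envDir)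
        + M.sigE t * M.corr * u) ^ 2 / (2 * (1 + 2 * (M.sigI t ^ 2 * K envDir)))
    - Real.log (1 + 2 * (M.sigI t ^ 2 * K envDir)) / 2 * x 4 ^ 2

/-- The first five coordinates. -/
def base (z : Fin 7 → ℝ) : Fin 5 → ℝ := ![z 0, z 1, z 2, z 3, z 4]

/-- The homogenized state `x` together with the order `q` of trader `i` and the rescaled leftover
`u` of trader `j`. -/
def extend (x : Fin 5 → ℝ) (q u : ℝ) : Fin 7 → ℝ := ![x 0, x 1, x 2, x 3, x 4, q, u]

/-- The direction of the order of trader `i`. -/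
def dirI : Fin 7 → ℝ := ![0, 0, 0, 0, 0, 1, 0]

/-- The direction of the rescaled leftover of trader `j`. -/
def dirJ : Fin 7 → ℝ := ![0, 0, 0, 0, 0, 0, 1]

theorem extend_eq (x : Fin 5 → ℝ) (q u : ℝ) :
    extend x q u = extend x 0 0 + q • dirI + u • dirJ := by
  funext i
  fin_cases i <;> simp [extend, dirI, dirJ]

theorem extend_add_dirI (x : Fin 5 → ℝ) (q u a : ℝ) :
    extend x q u + a • dirI = extend x (q + a) u := by
  funext i
  fin_cases i <;> simp [extend, dirI]

theorem extend_add_dirJ (x : Fin 5 → ℝ) (q u a : ℝ) :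
    extend x q u + a • dirJ = extend x q (u + a) := by
  funext i
  fin_cases i <;> simp [extend, dirJ]

theorem base_extend (x : Fin 5 → ℝ) (q u : ℝ) : base (extend x q u) = x := by
  funext i
  fin_cases i <;> simp [extend, base]

theorem linFam_extend {q u : ℝ → (Fin 5 → ℝ) → ℝ} (hq : LinFam q) (hu : LinFam u) (i : Fin 7) :
    LinFam (fun δ x => extend x (q δ x) (u δ x) i) := by
  fin_cases i
  · exact LinFam.coord 0
  · exact LinFam.coord 1
  · exact LinFam.coord 2
  · exact LinFam.coord 3
  · exact LinFam.coord 4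
  · exact hq
  · exact hu

/-- The equilibrium and value coefficients at one time: the order `q` of trader `i`, the rescaled
leftover `u` of trader `j`, the exponent `J` of trader `i`, and the parts `N`, `K` of the exponent
of trader `j`, as functions of `δ` and the homogenized state. -/
structure Coeffs where
  q : ℝ → (Fin 5 → ℝ) → ℝ
  u : ℝ → (Fin 5 → ℝ) → ℝ
  J : ℝ → (Fin 5 → ℝ) → ℝ
  N : ℝ → (Fin 5 → ℝ) → ℝ
  K : ℝ → (Fin 5 → ℝ) → ℝ

/-- The regularity of the coefficients at `δ = 0` and the bounds that propagate backwards. -/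
structure Coeffs.Regular (M : Market) (γ : ℝ) (D : Coeffs) : Prop where
  q : LinFam D.q
  u : LinFam D.u
  J : QuadFam D.J
  N : LinFam D.N
  K : QuadFam D.K
  J_ge : ∀ Q r : ℝ, γ * M.lam * (M.beta / 2 * Q ^ 2 - M.alpha / 2 * r ^ 2 - M.alpha * r * Q)
    ≤ D.J 0 ![Q, 0, M.alpha * M.lam * r, 0, 0]
  J_nonpos : ∀ x : Fin 5 → ℝ, x 0 = 0 → x 1 = 0 → D.J 0 x ≤ 0
  K_nonneg : ∀ x : Fin 5 → ℝ, x 1 = 0 → 0 ≤ D.K 0 x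

/-- The exponent of trader `i` as a quadratic form in state and actions. -/
def formI (M : Market) (t : ℕ) (γ : ℝ) (D : Coeffs) (δ : ℝ) (z : Fin 7 → ℝ) : ℝ :=
  exponentI M t γ (D.J δ) (base z) (z 5) (z 1 - δ * z 6)

/-- The part of the exponent of trader `j` that depends on `u`, as a quadratic form in state and
actions. -/
def formJ (M : Market) (t : ℕ) (D : Coeffs) (δ : ℝ) (z : Fin 7 → ℝ) : ℝ :=
  exponentJ M t δ (D.N δ) (D.K δ) (base z) (z 5) (z 6) - M.lam * z 1 * z 6

theorem formI_extend (M : Market) (t : ℕ) (γ : ℝ) (D : Coeffs) (δ : ℝ) (x : Fin 5 → ℝ)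
    (q u : ℝ) : formI M t γ D δ (extend x q u) = exponentI M t γ (D.J δ) x q (x 1 - δ * u) := by
  rw [formI, base_extend]
  rfl

theorem formJ_extend (M : Market) (t : ℕ) (D : Coeffs) (δ : ℝ) (x : Fin 5 → ℝ) (q u : ℝ) :
    formJ M t D δ (extend x q u)
      = exponentJ M t δ (D.N δ) (D.K δ) x q u - M.lam * x 1 * u := by
  rw [formJ, base_extend]
  rfl

/-- The Cramer determinant of the first-order conditions. -/
def nashDet (F G : (Fin 7 → ℝ) → ℝ) : ℝ :=
  4 * F dirI * G dirJ - pol F dirJ dirI * pol G dirI dirJ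

/-- The order of trader `i` that solves the first-order conditions. -/
def nashQ (F G : (Fin 7 → ℝ) → ℝ) (x : Fin 5 → ℝ) : ℝ :=
  (nashDet F G)⁻¹ *
    (pol F dirJ dirI * pol G (extend x 0 0) dirJ - 2 * G dirJ * pol F (extend x 0 0) dirI)

/-- The leftover of trader `j` that solves the first-order conditions. -/
def nashU (F G : (Fin 7 → ℝ) → ℝ) (x : Fin 5 → ℝ) : ℝ :=
  (nashDet F G)⁻¹ *
    (pol G dirI dirJ * pol F (extend x 0 0) dirI - 2 * F dirI * pol G (extend x 0 0) dirJ)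

/-- The coefficients at time `t` from those at time `t + 1`. -/
def Coeffs.prev (M : Market) (t : ℕ) (γ : ℝ) (D : Coeffs) : Coeffs where
  q δ x := nashQ (formI M t γ D δ) (formJ M t D δ) x
  u δ x := nashU (formI M t γ D δ) (formJ M t D δ) x
  J δ x := exponentI M t γ (D.J δ) x (nashQ (formI M t γ D δ) (formJ M t D δ) x)
    (x 1 - δ * nashU (formI M t γ D δ) (formJ M t D δ) x)
  N δ x := -M.lam * (nashQ (formI M t γ D δ) (formJ M t D δ) x
    + (x 1 - δ * nashU (formI M t γ D δ) (formJ M t D δ) x))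
  K δ x := -exponentJ M t δ (D.N δ) (D.K δ) x (nashQ (formI M t γ D δ) (formJ M t D δ) x)
    (nashU (formI M t γ D δ) (formJ M t D δ) x)

/-- The coefficients at the final time, when all the remaining volume is executed. -/
def Coeffs.final (M : Market) (γ : ℝ) : Coeffs where
  q _ x := x 0
  u _ _ := 0
  J _ x := γ * (M.lam * (x 0 + x 1) * x 0)
  N _ x := -M.lam * (x 0 + x 1)
  K _ _ := 0

theorem Coeffs.final_regular (M : Market) {γ : ℝ} (hγ : 0 < γ) :
    (Coeffs.final M γ).Regular M γ where
  q := LinFam.coord 0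
  u := LinFam.zero
  J := (QuadFam.mul (((LinFam.coord 0).add (LinFam.coord 1)).const_smul M.lam)
    (LinFam.coord 0)).const_smul γ
  N := ((LinFam.coord 0).add (LinFam.coord 1)).const_smul (-M.lam)
  K := QuadFam.zero
  -- The gap is `Q ^ 2 * (1 - α / 2 - β / 2) + α / 2 * (r + Q) ^ 2`, times `γ * λ`.
  J_ge Q r := by
    have h1 := M.alpha_mem.1
    have h2 := M.alpha_mem.2
    have h3 := M.beta_mem.2
    have h4 : 0 ≤ Q ^ 2 - (M.beta / 2 * Q ^ 2 - M.alpha / 2 * r ^ 2 - M.alpha * r * Q) := by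
      nlinarith [mul_nonneg h1 (sq_nonneg (r + Q)), mul_nonneg (sub_nonneg.2 h2) (sq_nonneg Q),
        mul_nonneg (sub_nonneg.2 h3) (sq_nonneg Q)]
    have h5 := mul_nonneg (mul_pos hγ M.lam_pos).le h4
    simp only [Coeffs.final, Matrix.cons_val_zero, Matrix.cons_val_one]
    nlinarith
  J_nonpos x h0 h1 := by simp [Coeffs.final, h0]
  K_nonneg x h1 := le_rfl

/-- A nonpositive random exponent has exponential moment at most `1`; this is the closed-form
version, homogenized by `y`. -/
theorem gaussian_bound {a b c : ℝ} (hc : c ≤ 0) (h : ∀ w : ℝ, a + b * w + c * w ^ 2 ≤ 0)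
    (y : ℝ) : a + b ^ 2 / (2 * (1 - 2 * c)) - Real.log (1 - 2 * c) / 2 * y ^ 2 ≤ 0 := by
  have hD : 0 < 1 - 2 * c := by linarith
  have hlog : 0 ≤ Real.log (1 - 2 * c) := Real.log_nonneg (by linarith)
  -- This point maximizes `b * w + c * w ^ 2 - w ^ 2 / 2`, with maximum `b ^ 2 / (2 * (1 - 2 * c))`.
  have h1 := h (b / (1 - 2 * c))
  have h2 : b * (b / (1 - 2 * c)) + c * (b / (1 - 2 * c)) ^ 2 - b ^ 2 / (2 * (1 - 2 * c))
      = b ^ 2 / (2 * (1 - 2 * c) ^ 2) := by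
    field_simp
    ring
  have h3 : 0 ≤ b ^ 2 / (2 * (1 - 2 * c) ^ 2) := by positivity
  have h4 : 0 ≤ Real.log (1 - 2 * c) / 2 * y ^ 2 := by positivity
  linarith

theorem Market.one_sub_corr_sq_pos (M : Market) : 0 < 1 - M.corr ^ 2 := by
  nlinarith [M.corr_mem.1, M.corr_mem.2]

variable {M : Market} {t : ℕ} {γ : ℝ} {D : Coeffs}

theorem linFam_base (i : Fin 5) : LinFam (fun _ z => base z i) := by
  fin_cases i
  · exact LinFam.coord 0
  · exact LinFam.coord 1
  · exact LinFam.coord 2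
  · exact LinFam.coord 3
  · exact LinFam.coord 4

theorem linFam_orderJ : LinFam (fun δ (z : Fin 7 → ℝ) => z 1 - δ * z 6) :=
  (LinFam.coord 1).sub ((LinFam.coord 6).smul continuousAt_id)

theorem linFam_drift (M : Market) (t : ℕ) (i : Fin 5) :
    LinFam (fun δ z => drift M t (base z) (z 5) (z 1 - δ * z 6) i) := by
  have hp := linFam_orderJ
  fin_cases i
  · exact (LinFam.coord 0).sub (LinFam.coord 5)
  · exact (LinFam.coord 1).sub hp
  · exact ((LinFam.coord 2).add (((LinFam.coord 5).add hp).const_smul _)).const_smul _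
  · exact ((LinFam.coord 4).const_smul _).sub ((LinFam.coord 3).const_smul _)
  · exact LinFam.coord 4

theorem linFam_slip (M : Market) (t : ℕ) :
    LinFam (fun δ z => slip M t (base z) (z 5) (z 1 - δ * z 6)) :=
  ((((LinFam.coord 5).add linFam_orderJ).const_smul _).sub ((LinFam.coord 2).const_smul _)).add
    (((LinFam.coord 4).const_smul _).sub ((LinFam.coord 3).const_smul _))

namespace Coeffs.Regular

theorem one_le_momentI (hD : D.Regular M γ) (t : ℕ) :
    1 ≤ 1 - 2 * (M.sigI t ^ 2 * D.J 0 envDir) := by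
  have := hD.J_nonpos envDir rfl rfl
  nlinarith [mul_nonneg (sq_nonneg (M.sigI t)) (neg_nonneg.2 this)]

theorem one_le_momentJ (hD : D.Regular M γ) (t : ℕ) :
    1 ≤ 1 + 2 * (M.sigI t ^ 2 * D.K 0 envDir) := by
  have := hD.K_nonneg envDir rfl
  nlinarith [mul_nonneg (sq_nonneg (M.sigI t)) this]

theorem continuousAt_momentI (hD : D.Regular M γ) (t : ℕ) :
    ContinuousAt (fun δ => 1 - 2 * (M.sigI t ^ 2 * D.J δ envDir)) 0 := by
  have := hD.J.continuousAt envDir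
  fun_prop

theorem continuousAt_momentJ (hD : D.Regular M γ) (t : ℕ) :
    ContinuousAt (fun δ => 1 + 2 * (M.sigI t ^ 2 * D.K δ envDir)) 0 := by
  have := hD.K.continuousAt envDir
  fun_prop

theorem quadFam_formI (hD : D.Regular M γ) (t : ℕ) : QuadFam (formI M t γ D) := by
  have hp := linFam_orderJ
  have hy := linFam_drift M t
  have hd : LinFam (fun (_ : ℝ) (z : Fin 7 → ℝ) => γ * (base z 0 - z 5)) :=
    ((linFam_base 0).sub (LinFam.coord 5)).const_smul γ
  have hpos := (zero_lt_one.trans_le (hD.one_le_momentI t)).ne'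
  have hc := hD.continuousAt_momentI t
  have hinv : ContinuousAt (fun δ => (2 * (1 - 2 * (M.sigI t ^ 2 * D.J δ envDir)))⁻¹) 0 :=
    (continuousAt_const.mul hc).inv₀ (mul_ne_zero two_ne_zero hpos)
  have h1 : QuadFam (fun δ (z : Fin 7 → ℝ) => γ * (M.lam * (z 5 + (z 1 - δ * z 6)) * z 5)) :=
    (QuadFam.mul (((LinFam.coord 5).add hp).const_smul _) (LinFam.coord 5)).const_smul _
  have h2 := QuadFam.mul (linFam_slip M t) hd
  have h3 := hD.J.comp hy
  have h4 := (QuadFam.sq hd).const_smul (M.sigE t ^ 2 * (1 - M.corr ^ 2) / 2)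
  have h5 := (QuadFam.sq (((hd.const_smul (M.sigI t)).add
      (((hD.J.pol envDir).comp hy).const_smul (M.sigI t))).add
      (hd.const_smul (M.sigE t * M.corr)))).smul hinv
  have h6 := (QuadFam.sq (hy 4)).smul ((hc.log hpos).div_const 2)
  convert (h1.add h2).add (((h3.add h4).add h5).sub h6) using 1
  funext δ z
  simp only [formI, exponentI, logMoment]
  ring

theorem quadFam_formJ (hD : D.Regular M γ) (t : ℕ) : QuadFam (formJ M t D) := by
  have hp := linFam_orderJ
  have hy := linFam_drift M t
  have hu : LinFam (fun (_ : ℝ) (z : Fin 7 → ℝ) => z 6) := LinFam.coord 6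
  have hpos := (zero_lt_one.trans_le (hD.one_le_momentJ t)).ne'
  have hc := hD.continuousAt_momentJ t
  have hinv : ContinuousAt (fun δ => (2 * (1 + 2 * (M.sigI t ^ 2 * D.K δ envDir)))⁻¹) 0 :=
    (continuousAt_const.mul hc).inv₀ (mul_ne_zero two_ne_zero hpos)
  have h1 : QuadFam (fun δ (z : Fin 7 → ℝ) => -(M.lam * (z 5 + (z 1 - δ * z 6)) * z 6)) :=
    (QuadFam.mul (((LinFam.coord 5).add hp).const_smul _) hu).neg
  have h2 := QuadFam.mul (linFam_slip M t) hu
  have h3 := QuadFam.mul hu (hD.N.comp hy)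
  have h3' := hD.K.comp hy
  have h4 := (QuadFam.sq hu).const_smul (M.sigE t ^ 2 * (1 - M.corr ^ 2) / 2)
  have h5 := (QuadFam.sq (((hu.const_smul (M.sigI t)).sub
      (((hu.smul (hD.N.continuousAt envDir)).add
        ((hD.K.pol envDir).comp hy)).const_smul (M.sigI t))).add
      (hu.const_smul (M.sigE t * M.corr)))).smul hinv
  have h6 := (QuadFam.sq (linFam_base 4)).smul ((hc.log hpos).div_const 2)
  have h7 := (QuadFam.mul (LinFam.coord 1) hu).const_smul M.lam
  convert ((((((h1.add h2).sub h3).sub h3').add h4).add h5).sub h6).sub h7 using 1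
  funext δ z
  have hb : base z 1 = z 1 := rfl
  simp only [formJ, exponentJ, hb]
  ring

/-- The bound `J_ge` for the state left by one unit order, with volume `-1` and residual `α * λ *
exp (-ρ)`, gives at least `γ * λ * (1 - β / 2 - α * exp (-2 * ρ) / 2)`, which is positive because `α
* exp (-ρ) + β < 1`. The Gaussian squares only add to it. -/
theorem formI_dirI_pos (hD : D.Regular M γ) (hγ : 0 < γ) (t : ℕ) : 0 < formI M t γ D 0 dirI := by
  have hpos := zero_lt_one.trans_le (hD.one_le_momentI t)
  have hJ := hD.J_ge (-1) (Real.exp (-M.rho))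
  have hcorr := M.one_sub_corr_sq_pos
  have hy : drift M t (base dirI) (dirI 5) (dirI 1 - 0 * dirI 6)
      = ![-1, 0, M.alpha * M.lam * Real.exp (-M.rho), 0, 0] := by
    funext i
    fin_cases i <;> simp [drift, base, dirI, mul_comm]
  have hd : γ * (base dirI 0 - dirI 5) = -γ := by simp [base, dirI]
  have he : Real.exp (-M.rho) ≤ 1 := Real.exp_le_one_iff.2 (by linarith [M.rho_nonneg])
  have he0 := Real.exp_pos (-M.rho)
  have hα := M.alpha_mem.1
  have hβ := M.beta_mem.1
  have hi := M.impact_lt_one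
  have hmain : 0 < 1 - (M.alpha * Real.exp (-M.rho) + M.beta)
      + (M.beta / 2 * (-1) ^ 2 - M.alpha / 2 * Real.exp (-M.rho) ^ 2
        - M.alpha * Real.exp (-M.rho) * (-1)) := by
    nlinarith [mul_nonneg (mul_nonneg hα he0.le) (sub_nonneg.2 he)]
  have hmain' := mul_pos (mul_pos hγ M.lam_pos) hmain
  rw [formI, exponentI, logMoment, hy, hd]
  have h1 : 0 ≤ M.sigE t ^ 2 * (1 - M.corr ^ 2) * (-γ) ^ 2 / 2 := by positivity
  have h2 : 0 ≤ (M.sigI t * -γ + M.sigI t * pol (D.J 0)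
      ![-1, 0, M.alpha * M.lam * Real.exp (-M.rho), 0, 0] envDir + M.sigE t * M.corr * -γ) ^ 2
      / (2 * (1 - 2 * (M.sigI t ^ 2 * D.J 0 envDir))) := by positivity
  have h3 : slip M t (base dirI) (dirI 5) (dirI 1 - 0 * dirI 6)
      = (M.alpha * Real.exp (-M.rho) + M.beta) * M.lam := by
    simp [slip, base, dirI]
  rw [h3]
  simp only [dirI, Matrix.cons_val]
  nlinarith

/-- At `δ = 0` the leftover does not move the drift. What remains is a nonnegative square plus `σ^ε
^ 2 * (1 - corr ^ 2) / 2`, positive because the news is nondegenerate given `ω`. -/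
theorem formJ_dirJ_pos (hD : D.Regular M γ) (ht : t ∈ Set.Icc 1 M.T) :
    0 < formJ M t D 0 dirJ := by
  have hpos := zero_lt_one.trans_le (hD.one_le_momentJ t)
  have hcorr := M.one_sub_corr_sq_pos
  have hs := M.sigE_pos t ht
  have hy : drift M t (base dirJ) (dirJ 5) (base dirJ 1 - 0 * dirJ 6) = 0 := by
    funext i
    fin_cases i <;> simp [drift, base, dirJ]
  have hN : D.N 0 0 = 0 := by simpa using hD.N.map_smul 0 0 0
  have hK : D.K 0 0 = 0 := hD.K.map_zero 0
  rw [formJ, exponentJ, hy, hN, hK]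
  have h1 : slip M t (base dirJ) (dirJ 5) (base dirJ 1 - 0 * dirJ 6) = 0 := by
    simp [slip, base, dirJ]
  rw [h1]
  have h2 : 0 ≤ (M.sigI t * dirJ 6 - M.sigI t * (dirJ 6 * D.N 0 envDir + pol (D.K 0) 0 envDir)
        + M.sigE t * M.corr * dirJ 6) ^ 2 / (2 * (1 + 2 * (M.sigI t ^ 2 * D.K 0 envDir))) := by
    positivity
  have h3 : 0 < M.sigE t ^ 2 * (1 - M.corr ^ 2) * dirJ 6 ^ 2 / 2 := by
    simp only [dirJ, Matrix.cons_val]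
    positivity
  have h4 : base dirJ 4 = 0 := rfl
  have h5 : base dirJ 1 = 0 := rfl
  have h6 : dirJ 5 = 0 := rfl
  have h7 : dirJ 1 = 0 := rfl
  rw [h4, h5, h6, h7]
  linarith

/-- At `δ = 0` the order of trader `j` does not depend on `u`, so trader `i` does not see `u`. -/
theorem pol_formI_dirJ (hD : D.Regular M γ) (t : ℕ) : pol (formI M t γ D 0) dirJ dirI = 0 := by
  have hF := hD.quadFam_formI t
  have h1 : formI M t γ D 0 (dirJ + dirI) = formI M t γ D 0 (extend 0 1 0) := by
    have : dirJ + dirI = extend 0 1 1 := by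
      funext i
      fin_cases i <;> simp [dirI, dirJ, extend]
    rw [this, formI_extend, formI_extend]
    simp
  have h2 : formI M t γ D 0 dirJ = formI M t γ D 0 (extend 0 0 0) := by
    have : dirJ = extend 0 0 1 := by
      funext i
      fin_cases i <;> simp [dirJ, extend]
    rw [this, formI_extend, formI_extend]
    simp
  have h3 : extend 0 1 0 = dirI := by
    funext i
    fin_cases i <;> simp [dirI, extend]
  have h4 : extend 0 0 0 = 0 := by
    funext i
    fin_cases i <;> simp [extend]
  rw [pol, h1, h2, h3, h4, hF.map_zero]
  ring

end Coeffs.Regular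

end Stage

/-! ### Solving the stage game and propagating regularity backwards. -/

section Solution

theorem pol_extend {F : ℝ → (Fin 7 → ℝ) → ℝ} (hF : QuadFam F) (δ : ℝ) (x : Fin 5 → ℝ) (q u : ℝ)
    (w : Fin 7 → ℝ) : pol (F δ) (extend x q u) w
      = pol (F δ) (extend x 0 0) w + q * pol (F δ) dirI w + u * pol (F δ) dirJ w := by
  have h := hF.pol w
  have h1 := h.map_add δ (extend x 0 0 + q • dirI) (u • dirJ)
  have h2 := h.map_add δ (extend x 0 0) (q • dirI)
  have h3 := h.map_smul δ q dirI
  have h4 := h.map_smul δ u dirJ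
  rw [extend_eq, h1, h2, h3, h4]

/-- The two first-order conditions are linear in `(q, u)` by `pol_extend`; this is Cramer's rule. -/
theorem nash_iff {F G : ℝ → (Fin 7 → ℝ) → ℝ} (hF : QuadFam F) (hG : QuadFam G) {δ : ℝ}
    (hdet : nashDet (F δ) (G δ) ≠ 0) (x : Fin 5 → ℝ) (q u : ℝ) :
    (pol (F δ) (extend x q u) dirI = 0 ∧ pol (G δ) (extend x q u) dirJ = 0)
      ↔ q = nashQ (F δ) (G δ) x ∧ u = nashU (F δ) (G δ) x := by
  rw [pol_extend hF, pol_extend hG, hF.pol_self, hG.pol_self]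
  unfold nashQ nashU
  have hd : nashDet (F δ) (G δ) = 4 * F δ dirI * G δ dirJ
    - pol (F δ) dirJ dirI * pol (G δ) dirI dirJ := rfl
  generalize nashDet (F δ) (G δ) = d at *
  generalize pol (F δ) (extend x 0 0) dirI = a at *
  generalize pol (G δ) (extend x 0 0) dirJ = b at *
  generalize pol (F δ) dirJ dirI = c at *
  generalize pol (G δ) dirI dirJ = e at *
  rw [eq_inv_mul_iff_mul_eq₀ hdet, eq_inv_mul_iff_mul_eq₀ hdet]
  constructor
  · rintro ⟨h1, h2⟩
    constructor
    · linear_combination q * hd + 2 * G δ dirJ * h1 - c * h2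
    · linear_combination u * hd - e * h1 + 2 * F δ dirI * h2
  · rintro ⟨h1, h2⟩
    constructor
    · refine (mul_eq_zero.1 (?_ : d * _ = 0)).resolve_left hdet
      linear_combination a * hd + 2 * F δ dirI * h1 + c * h2
    · refine (mul_eq_zero.1 (?_ : d * _ = 0)).resolve_left hdet
      linear_combination b * hd + e * h1 + 2 * G δ dirJ * h2

variable {M : Market} {t : ℕ} {γ : ℝ} {D : Coeffs}

namespace Coeffs.Regular

theorem nashDet_pos (hD : D.Regular M γ) (hγ : 0 < γ) (ht : t ∈ Set.Icc 1 M.T) :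
    0 < nashDet (formI M t γ D 0) (formJ M t D 0) := by
  have h1 := hD.formI_dirI_pos hγ t
  have h2 := hD.formJ_dirJ_pos ht
  rw [nashDet, hD.pol_formI_dirJ]
  have := mul_pos h1 h2
  linarith

theorem continuousAt_nashDet (hD : D.Regular M γ) (t : ℕ) :
    ContinuousAt (fun δ => nashDet (formI M t γ D δ) (formJ M t D δ)) 0 := by
  have hF := hD.quadFam_formI t
  have hG := hD.quadFam_formJ t
  exact ((continuousAt_const.mul (hF.continuousAt _)).mul (hG.continuousAt _)).sub
    (((hF.pol _).continuousAt _).mul ((hG.pol _).continuousAt _))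

theorem exponentI_isMin_iff (hD : D.Regular M γ) {δ : ℝ} (h : 0 < formI M t γ D δ dirI)
    (x : Fin 5 → ℝ) (q u : ℝ) :
    (∀ q', exponentI M t γ (D.J δ) x q (x 1 - δ * u)
        ≤ exponentI M t γ (D.J δ) x q' (x 1 - δ * u))
      ↔ pol (formI M t γ D δ) (extend x q u) dirI = 0 := by
  rw [← (hD.quadFam_formI t).isMin_iff δ h]
  simp only [extend_add_dirI, formI_extend]
  exact ⟨fun h a => h _, fun h q' => by simpa using h (q' - q)⟩

theorem exponentJ_isMin_iff (hD : D.Regular M γ) {δ : ℝ} (h : 0 < formJ M t D δ dirJ)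
    (x : Fin 5 → ℝ) (q u : ℝ) :
    (∀ u', exponentJ M t δ (D.N δ) (D.K δ) x q u - M.lam * x 1 * u
        ≤ exponentJ M t δ (D.N δ) (D.K δ) x q u' - M.lam * x 1 * u')
      ↔ pol (formJ M t D δ) (extend x q u) dirJ = 0 := by
  rw [← (hD.quadFam_formJ t).isMin_iff δ h]
  simp only [extend_add_dirJ, formJ_extend]
  exact ⟨fun h a => h _, fun h u' => by simpa using h (u' - u)⟩

/-- For small `δ` the stage game has a unique equilibrium, and its solution is regular. -/
theorem eventually_stage (hD : D.Regular M γ) (hγ : 0 < γ) (ht : t ∈ Set.Icc 1 M.T) :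
    ∀ᶠ δ in 𝓝 (0 : ℝ), 0 < 1 - 2 * (M.sigI t ^ 2 * D.J δ envDir) ∧
      0 < 1 + 2 * (M.sigI t ^ 2 * D.K δ envDir) ∧
      ∀ (x : Fin 5 → ℝ) (q u : ℝ),
        ((∀ q', exponentI M t γ (D.J δ) x q (x 1 - δ * u)
            ≤ exponentI M t γ (D.J δ) x q' (x 1 - δ * u)) ∧
          (∀ u', exponentJ M t δ (D.N δ) (D.K δ) x q u - M.lam * x 1 * u
            ≤ exponentJ M t δ (D.N δ) (D.K δ) x q u' - M.lam * x 1 * u'))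
        ↔ q = (D.prev M t γ).q δ x ∧ u = (D.prev M t γ).u δ x := by
  have hF := hD.quadFam_formI t
  have hG := hD.quadFam_formJ t
  filter_upwards [
    (hD.continuousAt_momentI t).eventually_const_lt (zero_lt_one.trans_le (hD.one_le_momentI t)),
    (hD.continuousAt_momentJ t).eventually_const_lt (zero_lt_one.trans_le (hD.one_le_momentJ t)),
    (hF.continuousAt dirI).eventually_const_lt (hD.formI_dirI_pos hγ t),
    (hG.continuousAt dirJ).eventually_const_lt (hD.formJ_dirJ_pos ht),
    (hD.continuousAt_nashDet t).eventually_const_lt (hD.nashDet_pos hγ ht)] with δ h1 h2 h3 h4 h5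
  refine ⟨h1, h2, fun x q u => ?_⟩
  rw [hD.exponentI_isMin_iff h3, hD.exponentJ_isMin_iff h4, nash_iff hF hG h5.ne']
  rfl

/-- At `δ = 0` trader `i` has a unique best reply to the immediate liquidation of trader `j`. -/
theorem exponentI_zero_isMin_iff (hD : D.Regular M γ) (hγ : 0 < γ) (ht : t ∈ Set.Icc 1 M.T)
    (x : Fin 5 → ℝ) (q : ℝ) :
    (∀ q', exponentI M t γ (D.J 0) x q (x 1) ≤ exponentI M t γ (D.J 0) x q' (x 1))
      ↔ q = (D.prev M t γ).q 0 x := by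
  obtain ⟨-, -, h⟩ := (hD.eventually_stage hγ ht).self_of_nhds
  have hsol := (h x _ _).2 ⟨rfl, rfl⟩
  have h1 := (hD.exponentI_isMin_iff (hD.formI_dirI_pos hγ t) x _ _).1 hsol.1
  have h2 := hD.exponentI_isMin_iff (hD.formI_dirI_pos hγ t) x q 0
  simp only [zero_mul, sub_zero] at h2
  have hF := hD.quadFam_formI t
  -- The mixed coefficient vanishes, so `u = 0` and the equilibrium leftover give the same equation
  -- for the order.
  rw [h2, pol_extend hF, hF.pol_self, hD.pol_formI_dirJ]
  rw [pol_extend hF, hF.pol_self, hD.pol_formI_dirJ] at h1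
  have h3 := hD.formI_dirI_pos hγ t
  constructor
  · intro h4
    have h5 : 2 * formI M t γ D 0 dirI * (q - (D.prev M t γ).q 0 x) = 0 := by
      linear_combination h4 - h1
    have := (mul_eq_zero.1 h5).resolve_left (by positivity)
    linarith
  · rintro rfl
    linear_combination h1

theorem prev_J_zero (D : Coeffs) (x : Fin 5 → ℝ) :
    (D.prev M t γ).J 0 x = exponentI M t γ (D.J 0) x ((D.prev M t γ).q 0 x) (x 1) := by
  simp [Coeffs.prev]

theorem prev_linFam_q (hD : D.Regular M γ) (hγ : 0 < γ) (ht : t ∈ Set.Icc 1 M.T) :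
    LinFam (D.prev M t γ).q := by
  have hF := hD.quadFam_formI t
  have hG := hD.quadFam_formJ t
  have he := linFam_extend (LinFam.zero (ι := Fin 5)) LinFam.zero
  exact ((((hG.pol dirJ).comp he).smul ((hF.pol dirI).continuousAt dirJ)).sub
    (((hF.pol dirI).comp he).smul (continuousAt_const.mul (hG.continuousAt dirJ)))).smul
      ((hD.continuousAt_nashDet t).inv₀ (hD.nashDet_pos hγ ht).ne')

theorem prev_linFam_u (hD : D.Regular M γ) (hγ : 0 < γ) (ht : t ∈ Set.Icc 1 M.T) :
    LinFam (D.prev M t γ).u := by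
  have hF := hD.quadFam_formI t
  have hG := hD.quadFam_formJ t
  have he := linFam_extend (LinFam.zero (ι := Fin 5)) LinFam.zero
  exact ((((hF.pol dirI).comp he).smul ((hG.pol dirJ).continuousAt dirI)).sub
    (((hG.pol dirJ).comp he).smul (continuousAt_const.mul (hF.continuousAt dirI)))).smul
      ((hD.continuousAt_nashDet t).inv₀ (hD.nashDet_pos hγ ht).ne')

/-- The bound reproduces itself for every order `q`: after the Gaussian squares are dropped, the
impact terms telescope and the gap is `γ * λ` times the nonnegative expression in `h3`. -/
theorem exponentI_ge (hD : D.Regular M γ) (hγ : 0 < γ) (t : ℕ) (Q r q : ℝ) :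
    γ * M.lam * (M.beta / 2 * Q ^ 2 - M.alpha / 2 * r ^ 2 - M.alpha * r * Q)
      ≤ exponentI M t γ (D.J 0) ![Q, 0, M.alpha * M.lam * r, 0, 0] q 0 := by
  have hpos := zero_lt_one.trans_le (hD.one_le_momentI t)
  have hcorr := M.one_sub_corr_sq_pos
  set e := Real.exp (-M.rho) with he_def
  have hJ := hD.J_ge (Q - q) (e * (r + q))
  have hy : drift M t ![Q, 0, M.alpha * M.lam * r, 0, 0] q 0
      = ![Q - q, 0, M.alpha * M.lam * (e * (r + q)), 0, 0] := by
    funext i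
    fin_cases i <;> simp [drift, ← he_def]
    ring
  have hs : slip M t ![Q, 0, M.alpha * M.lam * r, 0, 0] q 0
      = M.lam * ((M.alpha * e + M.beta) * q - (1 - e) * (M.alpha * r)) := by
    simp [slip, ← he_def]
    ring
  rw [exponentI, logMoment, hy, hs]
  simp only [Matrix.cons_val]
  have h1 : 0 ≤ M.sigE t ^ 2 * (1 - M.corr ^ 2) * (γ * (Q - q)) ^ 2 / 2 := by positivity
  have h2 : 0 ≤ (M.sigI t * (γ * (Q - q)) + M.sigI t * pol (D.J 0)
      ![Q - q, 0, M.alpha * M.lam * (e * (r + q)), 0, 0] envDir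
      + M.sigE t * M.corr * (γ * (Q - q))) ^ 2
      / (2 * (1 - 2 * (M.sigI t ^ 2 * D.J 0 envDir))) := by positivity
  have he : e ≤ 1 := Real.exp_le_one_iff.2 (by linarith [M.rho_nonneg])
  have he0 : 0 < e := Real.exp_pos (-M.rho)
  have hα := M.alpha_mem
  have hβ := M.beta_mem
  have h3 : 0 ≤ q ^ 2 * (1 - M.beta / 2 - M.alpha / 2)
      + M.alpha / 2 * (1 - e ^ 2) * (r + q) ^ 2 := by
    have : 0 ≤ 1 - e ^ 2 := by nlinarith
    have h4 : 0 ≤ 1 - M.beta / 2 - M.alpha / 2 := by linarith [hα.2, hβ.2]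
    have := hα.1
    positivity
  have h5 := mul_nonneg (mul_pos hγ M.lam_pos).le h3
  nlinarith

/-- Without volumes to execute and without trading, the next state has zero volumes for every `ω`,
so `J_nonpos` bounds the exponent pointwise and `gaussian_bound` bounds its moment. -/
theorem exponentI_nonpos (hD : D.Regular M γ) (t : ℕ) {x : Fin 5 → ℝ} (h0 : x 0 = 0)
    (h1 : x 1 = 0) : exponentI M t γ (D.J 0) x 0 0 ≤ 0 := by
  have hc := hD.J_nonpos envDir rfl rfl
  have key : ∀ w : ℝ, D.J 0 (drift M t x 0 0) + M.sigI t * pol (D.J 0) (drift M t x 0 0) envDir * w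
      + M.sigI t ^ 2 * D.J 0 envDir * w ^ 2 ≤ 0 := fun w => by
    have h := hD.J_nonpos (drift M t x 0 0 + (M.sigI t * w) • envDir)
      (by simp [drift, envDir, h0]) (by simp [drift, envDir, h1])
    rw [hD.J.map_add_smul] at h
    linarith
  have h := gaussian_bound (mul_nonpos_of_nonneg_of_nonpos (sq_nonneg (M.sigI t)) hc) key
    (drift M t x 0 0 4)
  simp only [exponentI, logMoment, h0]
  simpa using h

theorem exponentJ_nonpos (hD : D.Regular M γ) (t : ℕ) {x : Fin 5 → ℝ} (h1 : x 1 = 0) (q : ℝ) :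
    exponentJ M t 0 (D.N 0) (D.K 0) x q 0 ≤ 0 := by
  have hc := hD.K_nonneg envDir rfl
  have key : ∀ w : ℝ, -D.K 0 (drift M t x q 0)
      + -(M.sigI t * pol (D.K 0) (drift M t x q 0) envDir) * w
      + -(M.sigI t ^ 2 * D.K 0 envDir) * w ^ 2 ≤ 0 := fun w => by
    have h := hD.K_nonneg (drift M t x q 0 + (M.sigI t * w) • envDir)
      (by simp [drift, envDir, h1])
    rw [hD.K.map_add_smul] at h
    linarith
  have h := gaussian_bound (neg_nonpos.2 (mul_nonneg (sq_nonneg (M.sigI t)) hc)) key (x 4)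
  simp only [exponentJ, h1]
  simpa using h

theorem prev (hD : D.Regular M γ) (hγ : 0 < γ) (ht : t ∈ Set.Icc 1 M.T) :
    (D.prev M t γ).Regular M γ := by
  have hq := hD.prev_linFam_q hγ ht
  have hu := hD.prev_linFam_u hγ ht
  have he := linFam_extend hq hu
  have hp : LinFam (fun δ (x : Fin 5 → ℝ) => x 1 - δ * (D.prev M t γ).u δ x) :=
    (LinFam.coord 1).sub (hu.smul continuousAt_id)
  have hJ : (D.prev M t γ).J
      = fun δ x => formI M t γ D δ (extend x ((D.prev M t γ).q δ x) ((D.prev M t γ).u δ x)) := by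
    funext δ x
    rw [formI_extend]
    rfl
  have hK : (D.prev M t γ).K = fun δ x =>
      -(formJ M t D δ (extend x ((D.prev M t γ).q δ x) ((D.prev M t γ).u δ x))
        + M.lam * (x 1 * (D.prev M t γ).u δ x)) := by
    funext δ x
    rw [formJ_extend]
    simp only [Coeffs.prev]
    ring
  obtain ⟨-, -, hnash⟩ := (hD.eventually_stage hγ ht).self_of_nhds
  refine ⟨hq, hu, ?_, (hq.add hp).const_smul _, ?_, ?_, ?_, ?_⟩
  · rw [hJ]
    exact (hD.quadFam_formI t).comp he
  · rw [hK]
    exact (((hD.quadFam_formJ t).comp he).add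
      ((QuadFam.mul (LinFam.coord 1) hu).const_smul _)).neg
  · intro Q r
    rw [prev_J_zero]
    exact hD.exponentI_ge hγ t Q r _
  · intro x h0 h1
    rw [prev_J_zero]
    -- The optimal order is at least as good as not trading.
    refine ((hD.exponentI_zero_isMin_iff hγ ht x _).2 rfl 0).trans ?_
    rw [h1]
    exact hD.exponentI_nonpos t h0 h1
  · intro x h1
    -- The competitor is the zero leftover.
    have h2 := ((hnash x _ _).2 ⟨rfl, rfl⟩).2 0
    have h3 := hD.exponentJ_nonpos t h1 ((D.prev M t γ).q 0 x)
    simp only [h1, mul_zero, zero_mul, sub_zero] at h2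
    exact neg_nonneg.2 (h2.trans h3)

end Coeffs.Regular

/-- The coefficients `n` periods before the final time. -/
def coeffsRev (M : Market) (γ : ℝ) : ℕ → Coeffs
  | 0 => Coeffs.final M γ
  | n + 1 => (coeffsRev M γ n).prev M (M.T - (n + 1)) γ

/-- The coefficients at time `t`. -/
def coeffs (M : Market) (γ : ℝ) (t : ℕ) : Coeffs := coeffsRev M γ (M.T - t)

theorem coeffs_final (M : Market) (γ : ℝ) : coeffs M γ M.T = Coeffs.final M γ := by
  simp [coeffs, coeffsRev]

theorem coeffs_prev (M : Market) (γ : ℝ) {t : ℕ} (ht : t < M.T) :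
    coeffs M γ t = (coeffs M γ (t + 1)).prev M t γ := by
  rw [coeffs, coeffs, show M.T - t = M.T - (t + 1) + 1 by omega, coeffsRev]
  congr 1
  omega

theorem coeffs_regular (M : Market) {γ : ℝ} (hγ : 0 < γ) {t : ℕ} (ht : t ∈ Set.Icc 1 M.T) :
    (coeffs M γ t).Regular M γ := by
  obtain ⟨h1, h2⟩ := ht
  induction h2 using Nat.decreasingInduction with
  | self => rw [coeffs_final]; exact Coeffs.final_regular M hγ
  | of_succ k hk ih => rw [coeffs_prev M γ hk]; exact (ih (by omega)).prev hγ ⟨h1, hk.le⟩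

end Solution

/-! ### From exponents to stage costs. -/

section Exponent

variable {ι : Type} [Fintype ι] {Ω : Type*} [MeasurableSpace Ω]

/-- The expected loss at time `t` is the exponential of `-γ (W - P Q)` plus a function `J` of the
coordinates `X`. -/
def HasExponent (M : Market) (P : Measure Ω) (ξ : ℕ → Ω → ℝ × ℝ) (γ : ℝ) (k : ι)
    (π : ι → Strategy ι) (t : ℕ) (X : State ι → Fin 5 → ℝ) (J : (Fin 5 → ℝ) → ℝ) : Prop :=
  ∀ s, cost M P ξ γ k π t s = ENNReal.ofReal
    (Real.exp (-γ * (s.wealth k - s.price * s.remaining k) + J (X s)))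

variable {P : Measure Ω} {M : Market} {ξ : ℕ → Ω → ℝ × ℝ}

/-- In `W - P * Q` the new price enters only through its increment times the leftover volume, so the
current price factors out. The expansion of `J` is required only along `envDir`, so that the
exponent of trader `j`, singular in `δ`, is also covered. -/
theorem HasExponent.stageCost_eq {γ : ℝ} {k : ι} {π : ι → Strategy ι} {t : ℕ}
    {X : State ι → Fin 5 → ℝ} {J : (Fin 5 → ℝ) → ℝ} (h : HasExponent M P ξ γ k π (t + 1) X J)
    (hJ : ∀ (y : Fin 5 → ℝ) (a : ℝ),
      J (y + a • envDir) = J y + a * pol J y envDir + a ^ 2 * J envDir)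
    (hpos : 0 < 1 - 2 * (M.sigI t ^ 2 * J envDir)) {s : State ι} {q : ι → ℝ} {y : Fin 5 → ℝ}
    (hX : ∀ n, X (step M t s q n) = y + (M.sigI t * n.1) • envDir) (hy : y 4 = 1) :
    stageCost M P ξ γ k π t s q = ENNReal.ofReal (Real.exp
      (-γ * (s.wealth k - s.price * s.remaining k) + (γ * (M.lam * (∑ l, q l) * q k)
        + ((M.alpha * Real.exp (-M.rho) + M.beta) * M.lam * (∑ l, q l)
            - (1 - Real.exp (-M.rho)) * s.residual + (M.aI t - M.bI t * s.env))
          * (γ * (s.remaining k - q k))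
        + logMoment M t J y (γ * (s.remaining k - q k))))) := by
  set d := γ * (s.remaining k - q k) with hd
  have hint := lintegral_exp_noiseLaw (c := M.corr) (s := M.sigE t) M.corr_mem
    (-γ * (s.wealth k - s.price * s.remaining k) + γ * (M.lam * (∑ l, q l) * q k)
        + ((M.alpha * Real.exp (-M.rho) + M.beta) * M.lam * (∑ l, q l)
            - (1 - Real.exp (-M.rho)) * s.residual + (M.aI t - M.bI t * s.env)) * d + J y)
    (M.sigI t * d + M.sigI t * pol J y envDir) (M.sigI t ^ 2 * J envDir) d hpos
  have hlog : logMoment M t J y d = J y + M.sigE t ^ 2 * (1 - M.corr ^ 2) * d ^ 2 / 2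
      + (M.sigI t * d + M.sigI t * pol J y envDir + M.sigE t * M.corr * d) ^ 2
        / (2 * (1 - 2 * (M.sigI t ^ 2 * J envDir)))
      - Real.log (1 - 2 * (M.sigI t ^ 2 * J envDir)) / 2 := by
    rw [logMoment, hy]
    ring
  rw [hlog]
  convert hint using 1
  · refine lintegral_congr fun n => ?_
    rw [h, hX, hJ]
    congr 2
    simp only [step, State.wealth, State.price, State.remaining, State.residual, State.env] at hd ⊢
    rw [hd]
    ring
  · congr 2
    ring

variable [IsProbabilityMeasure P]

theorem stageCost_final (γ : ℝ) (k : ι) (π : ι → Strategy ι) (s : State ι) (q : ι → ℝ) :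
    stageCost M P ξ γ k π M.T s q = if q k = s.remaining k then
      ENNReal.ofReal (Real.exp (-γ * (s.wealth k - s.price * s.remaining k)
        + γ * (M.lam * (∑ l, q l) * s.remaining k))) else ⊤ := by
  have h : ∀ n, cost M P ξ γ k π (M.T + 1) (step M M.T s q n)
      = if q k = s.remaining k then
      ENNReal.ofReal (Real.exp (-γ * (s.wealth k - s.price * s.remaining k)
        + γ * (M.lam * (∑ l, q l) * s.remaining k))) else ⊤ := fun n => by
    rw [cost_terminal, loss]
    have : (step M M.T s q n).remaining k = s.remaining k - q k := rfl
    rw [this]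
    by_cases hq : q k = s.remaining k
    · rw [if_pos (by rw [hq, sub_self]), if_pos hq]
      congr 2
      simp only [step, State.wealth, State.price]
      rw [hq]
      ring
    · rw [if_neg (fun h => hq (sub_eq_zero.1 h).symm), if_neg hq]
  simp only [stageCost, h, lintegral_const, measure_univ, mul_one]

/-- At the final time any unexecuted volume costs `⊤`, while full execution has finite cost. -/
theorem stageCost_final_isMin_iff [DecidableEq ι] (γ : ℝ) (k : ι) (π : ι → Strategy ι)
    (s : State ι) (q : ι → ℝ) :
    (∀ q', stageCost M P ξ γ k π M.T s q ≤ stageCost M P ξ γ k π M.T s (Function.update q k q'))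
      ↔ q k = s.remaining k := by
  constructor
  · intro h
    by_contra hne
    have h1 := h (s.remaining k)
    rw [stageCost_final, stageCost_final, if_neg hne, if_pos (by simp)] at h1
    exact ENNReal.ofReal_ne_top (top_le_iff.1 h1)
  · intro h q'
    by_cases h' : q' = q k
    · rw [h', Function.update_eq_self]
    · rw [stageCost_final _ _ _ _ (Function.update q k q'), if_neg]
      · exact le_top
      · simpa [← h] using h'

end Exponent

theorem ofReal_exp_le_iff {a b c : ℝ} :
    ENNReal.ofReal (Real.exp (a + b)) ≤ ENNReal.ofReal (Real.exp (a + c)) ↔ b ≤ c := by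
  rw [ENNReal.ofReal_le_ofReal_iff (Real.exp_pos _).le, Real.exp_le_exp, add_le_add_iff_left]

/-! ### The single-trader market. -/

section Single

variable {Ω : Type*} [MeasurableSpace Ω] {P : Measure Ω} {M : Market}
  {ξ : ℕ → Ω → ℝ × ℝ} {γ : ℝ}

/-- The homogenized coordinates of a single trader. -/
def coordsSingle (s : State Unit) : Fin 5 → ℝ := ![s.remaining (), 0, s.residual, s.env, 1]

theorem coordsSingle_step (M : Market) (t : ℕ) (s : State Unit) (q : Unit → ℝ) (n : ℝ × ℝ) :
    coordsSingle (step M t s q n)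
      = drift M t (coordsSingle s) (q ()) 0 + (M.sigI t * n.1) • envDir := by
  funext l
  fin_cases l <;> simp [coordsSingle, step, drift, envDir]

/-- From time `t` on, `π` follows the optimal rules of the single trader. -/
def FollowsSingle (M : Market) (γ : ℝ) (π : Unit → Strategy Unit) (t : ℕ) : Prop :=
  ∀ u, t ≤ u → u ≤ M.T → ∀ s, orders π u s () = (coeffs M γ u).q 0 (coordsSingle s)

theorem stageCost_single (hγ : 0 < γ) {π : Unit → Strategy Unit} {t : ℕ} (h1 : 1 ≤ t)
    (ht : t < M.T)
    (h : HasExponent M P ξ γ () π (t + 1) coordsSingle ((coeffs M γ (t + 1)).J 0))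
    (s : State Unit) (q : Unit → ℝ) :
    stageCost M P ξ γ () π t s q = ENNReal.ofReal (Real.exp
      (-γ * (s.wealth () - s.price * s.remaining ())
        + exponentI M t γ ((coeffs M γ (t + 1)).J 0) (coordsSingle s) (q ()) 0)) := by
  have hD := coeffs_regular M hγ (t := t + 1) ⟨by omega, ht⟩
  rw [h.stageCost_eq (fun y a => hD.J.map_add_smul 0 a y envDir)
    (zero_lt_one.trans_le (hD.one_le_momentI t)) (coordsSingle_step M t s q) rfl]
  congr 2
  simp [exponentI, slip, coordsSingle]

variable [IsProbabilityMeasure P]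

theorem hasExponent_single (hξ : IsMarketNoise M P ξ) (hγ : 0 < γ) {π : Unit → Strategy Unit}
    {t : ℕ} (ht : t ∈ Set.Icc 1 M.T) (hπ : FollowsSingle M γ π t) :
    HasExponent M P ξ γ () π t coordsSingle ((coeffs M γ t).J 0) := by
  obtain ⟨h1, h2⟩ := ht
  induction h2 using Nat.decreasingInduction with
  | self =>
    intro s
    have hq := hπ M.T le_rfl le_rfl s
    rw [coeffs_final] at hq ⊢
    rw [cost_step hξ _ _ _ ⟨h1, le_rfl⟩]
    refine (stageCost_final γ () π s (orders π M.T s)).trans ?_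
    rw [if_pos (by rw [hq]; rfl)]
    congr 2
    simp [hq, Coeffs.final, coordsSingle]
  | of_succ k hk ih =>
    intro s
    have hq := hπ k le_rfl hk.le s
    have h := ih (fun u hu => hπ u (by omega)) (by omega)
    rw [cost_step hξ _ _ _ ⟨h1, hk.le⟩]
    refine (stageCost_single hγ h1 hk h s _).trans ?_
    rw [coeffs_prev M γ hk, Coeffs.Regular.prev_J_zero, hq, coeffs_prev M γ hk]
    rfl

theorem single_isMin_iff (hξ : IsMarketNoise M P ξ) (hγ : 0 < γ) {π : Unit → Strategy Unit}
    {t : ℕ} (ht : t ∈ Set.Icc 1 M.T) (hπ : FollowsSingle M γ π (t + 1)) (s : State Unit)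
    (q : Unit → ℝ) :
    (∀ q', stageCost M P ξ γ () π t s q ≤ stageCost M P ξ γ () π t s (Function.update q () q'))
      ↔ q () = (coeffs M γ t).q 0 (coordsSingle s) := by
  rcases ht.2.eq_or_lt with rfl | hlt
  · rw [stageCost_final_isMin_iff, coeffs_final]
    rfl
  · have h := hasExponent_single hξ hγ ⟨by omega, hlt⟩ hπ
    have hD := coeffs_regular M hγ (t := t + 1) ⟨by omega, hlt⟩
    simp only [stageCost_single hγ ht.1 hlt h, ofReal_exp_le_iff, Function.update_self]
    rw [coeffs_prev M γ hlt]
    exact hD.exponentI_zero_isMin_iff hγ ht (coordsSingle s) (q ())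

/-- Backwards in time, optimality at every state excludes profitable one-shot deviations, and the
stage minimizer is unique once the later rules are known. -/
theorem followsSingle_of_optimal (hξ : IsMarketNoise M P ξ) (hγ : 0 < γ) {π : Strategy Unit}
    (hπ : IsOptimalExecution M P ξ γ π) : FollowsSingle M γ (fun _ => π) 1 := by
  suffices H : ∀ t ≤ M.T + 1, 1 ≤ t → FollowsSingle M γ (fun _ => π) t from
    H 1 (by omega) le_rfl
  intro t ht
  induction ht using Nat.decreasingInduction with
  | self => intro _ u hu hu'; omega
  | of_succ k hk ih =>
    intro h1 u hu hu' s
    rcases hu.eq_or_lt with rfl | hlt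
    · have hmem : k ∈ Set.Icc 1 M.T := ⟨h1, hu'⟩
      refine (single_isMin_iff hξ hγ hmem (ih (by omega)) s _).1
        (stageCost_le_of_optimal hξ hmem s fun σ => ?_)
      have h2 := (value_le_value_iff γ () (fun _ => π) (fun _ => σ) k s).1 (hπ k hmem s σ)
      convert h2 using 2
      funext l
      simp
    · exact ih (by omega) u hlt hu' s

theorem exists_optimalExecution (hξ : IsMarketNoise M P ξ) (hγ : 0 < γ) :
    ∃ π : Strategy Unit, IsOptimalExecution M P ξ γ π := by
  classical
  let π : Strategy Unit :=
    ⟨fun t s => if t ∈ Set.Icc 1 M.T then (coeffs M γ t).q 0 (coordsSingle s) else 0, fun t => by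
      by_cases ht : t ∈ Set.Icc 1 M.T
      · simp only [if_pos ht]
        refine ((coeffs_regular M hγ ht).q.continuous 0).measurable.comp ?_
        unfold coordsSingle State.remaining State.residual State.env
        refine measurable_pi_iff.2 fun l => ?_
        fin_cases l <;> simp <;> fun_prop
      · simp only [if_neg ht, measurable_const]⟩
  have hπ : FollowsSingle M γ (fun _ => π) 1 := fun u h1 h2 s =>
    if_pos (show u ∈ Set.Icc 1 M.T from ⟨h1, h2⟩)
  refine ⟨π, fun t ht s σ => (value_le_value_iff γ () (fun _ => π) (fun _ => σ) t s).2 ?_⟩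
  have h := optimal_of_stageCost_le (π := fun _ => π) (γ := γ) (k := ()) hξ (fun t ht s q =>
    (single_isMin_iff hξ hγ ht (fun u hu => hπ u (by omega)) s _).2
      (hπ t ht.1 ht.2 s) q) ht s σ
  convert h using 2
  funext l
  simp

end Single

/-! ### The two-trader game and its limit. -/

section Game

variable {Ω : Type*} [MeasurableSpace Ω] {P : Measure Ω} {M : Market}
  {ξ : ℕ → Ω → ℝ × ℝ} {γ δ : ℝ} {i j : Fin 2}

/-- The homogenized coordinates of the two traders. -/
def coordsGame (i j : Fin 2) (s : State (Fin 2)) : Fin 5 → ℝ :=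
  ![s.remaining i, s.remaining j, s.residual, s.env, 1]

theorem sum_fin_two_of_ne (hij : i ≠ j) (q : Fin 2 → ℝ) : ∑ k, q k = q i + q j := by
  rw [Fin.sum_univ_two]
  fin_cases i <;> fin_cases j <;> simp_all [add_comm]

theorem coordsGame_step (hij : i ≠ j) (M : Market) (t : ℕ) (s : State (Fin 2)) (q : Fin 2 → ℝ)
    (n : ℝ × ℝ) : coordsGame i j (step M t s q n)
      = drift M t (coordsGame i j s) (q i) (q j) + (M.sigI t * n.1) • envDir := by
  funext l
  fin_cases l <;> simp [coordsGame, step, drift, envDir, -Fin.sum_univ_two, sum_fin_two_of_ne hij]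

/-- The exponent of trader `j` with risk aversion `δ⁻¹`. -/
def Coeffs.exponent (D : Coeffs) (δ : ℝ) (x : Fin 5 → ℝ) : ℝ :=
  -(δ⁻¹ * (x 1 * D.N δ x)) - D.K δ x

/-- The stage game at time `t` has a unique equilibrium, given by the coefficients. -/
def StageSolvable (M : Market) (γ δ : ℝ) (t : ℕ) : Prop :=
  0 < 1 - 2 * (M.sigI t ^ 2 * (coeffs M γ (t + 1)).J δ envDir) ∧
    0 < 1 + 2 * (M.sigI t ^ 2 * (coeffs M γ (t + 1)).K δ envDir) ∧
    ∀ (x : Fin 5 → ℝ) (q u : ℝ),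
      ((∀ q', exponentI M t γ ((coeffs M γ (t + 1)).J δ) x q (x 1 - δ * u)
          ≤ exponentI M t γ ((coeffs M γ (t + 1)).J δ) x q' (x 1 - δ * u)) ∧
        (∀ u', exponentJ M t δ ((coeffs M γ (t + 1)).N δ) ((coeffs M γ (t + 1)).K δ) x q u
            - M.lam * x 1 * u
          ≤ exponentJ M t δ ((coeffs M γ (t + 1)).N δ) ((coeffs M γ (t + 1)).K δ) x q u'
            - M.lam * x 1 * u'))
      ↔ q = (coeffs M γ t).q δ x ∧ u = (coeffs M γ t).u δ x

theorem eventually_stageSolvable (M : Market) (hγ : 0 < γ) :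
    ∀ᶠ δ in 𝓝 (0 : ℝ), ∀ t ∈ Set.Ico 1 M.T, StageSolvable M γ δ t := by
  refine (eventually_all_finite (Set.finite_Ico 1 M.T)).2 fun t ht => ?_
  have h := (coeffs_regular M hγ (t := t + 1) ⟨by omega, ht.2⟩).eventually_stage hγ
    (t := t) ⟨ht.1, ht.2.le⟩
  rw [← coeffs_prev M γ ht.2] at h
  exact h

/-- From time `t` on, `π` follows the equilibrium rules. -/
def FollowsGame (M : Market) (γ δ : ℝ) (i j : Fin 2) (π : Fin 2 → Strategy (Fin 2)) (t : ℕ) :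
    Prop :=
  ∀ u, t ≤ u → u ≤ M.T → ∀ s, orders π u s i = (coeffs M γ u).q δ (coordsGame i j s) ∧
    orders π u s j = coordsGame i j s 1 - δ * (coeffs M γ u).u δ (coordsGame i j s)

theorem stageCost_gameI (hij : i ≠ j) (hγ : 0 < γ) {π : Fin 2 → Strategy (Fin 2)} {t : ℕ}
    (h1 : 1 ≤ t) (ht : t < M.T) (hs : StageSolvable M γ δ t)
    (h : HasExponent M P ξ γ i π (t + 1) (coordsGame i j) ((coeffs M γ (t + 1)).J δ))
    (s : State (Fin 2)) (q : Fin 2 → ℝ) :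
    stageCost M P ξ γ i π t s q = ENNReal.ofReal (Real.exp
      (-γ * (s.wealth i - s.price * s.remaining i)
        + exponentI M t γ ((coeffs M γ (t + 1)).J δ) (coordsGame i j s) (q i) (q j))) := by
  have hD := coeffs_regular M hγ (t := t + 1) ⟨by omega, ht⟩
  rw [h.stageCost_eq (fun y a => hD.J.map_add_smul δ a y envDir) hs.1
    (coordsGame_step hij M t s q) rfl, sum_fin_two_of_ne hij]
  congr 2
  simp [exponentI, slip, coordsGame]

/-- The only terms singular in `δ` do not involve `u`, so they drop out of the minimization over the
order of trader `j`. -/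
theorem stageCost_gameJ (hij : i ≠ j) (hγ : 0 < γ) (hδ : δ ≠ 0)
    {π : Fin 2 → Strategy (Fin 2)} {t : ℕ}
    (h1 : 1 ≤ t) (ht : t < M.T) (hs : StageSolvable M γ δ t)
    (h : HasExponent M P ξ δ⁻¹ j π (t + 1) (coordsGame i j) ((coeffs M γ (t + 1)).exponent δ))
    (s : State (Fin 2)) (q : Fin 2 → ℝ) (u : ℝ) (hq : q j = coordsGame i j s 1 - δ * u) :
    stageCost M P ξ δ⁻¹ j π t s q = ENNReal.ofReal (Real.exp
      (-δ⁻¹ * (s.wealth j - s.price * s.remaining j)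
        + (δ⁻¹ * (M.lam * (q i + coordsGame i j s 1) * coordsGame i j s 1)
          + (exponentJ M t δ ((coeffs M γ (t + 1)).N δ) ((coeffs M γ (t + 1)).K δ)
            (coordsGame i j s) (q i) u - M.lam * coordsGame i j s 1 * u)))) := by
  have hD := coeffs_regular M hγ (t := t + 1) ⟨by omega, ht⟩
  set D := coeffs M γ (t + 1) with hDdef
  have he : D.exponent δ envDir = -D.K δ envDir := by simp [Coeffs.exponent, envDir]
  have hN := fun y => hD.N.map_add δ y envDir
  have hpol : ∀ y, pol (D.exponent δ) y envDir
      = -(δ⁻¹ * (y 1 * D.N δ envDir)) - pol (D.K δ) y envDir := fun y => by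
    have : (y + envDir) 1 = y 1 := by simp [envDir]
    rw [pol, pol, he]
    simp only [Coeffs.exponent, hN, this]
    ring
  have hJ : ∀ (y : Fin 5 → ℝ) (a : ℝ), D.exponent δ (y + a • envDir)
      = D.exponent δ y + a * pol (D.exponent δ) y envDir + a ^ 2 * D.exponent δ envDir := by
    intro y a
    have : (y + a • envDir) 1 = y 1 := by simp [envDir]
    rw [hpol, he]
    simp only [Coeffs.exponent, hD.K.map_add_smul, hD.N.map_add, hD.N.map_smul, this]
    ring
  have hpos : 0 < 1 - 2 * (M.sigI t ^ 2 * D.exponent δ envDir) := by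
    rw [he]
    have := hs.2.1
    linarith
  rw [h.stageCost_eq hJ hpos (coordsGame_step hij M t s q) rfl, sum_fin_two_of_ne hij]
  congr 2
  have hu : δ⁻¹ * (s.remaining j - q j) = u := by
    rw [hq]
    simp only [coordsGame, Matrix.cons_val]
    field_simp
    ring
  have hy1 : drift M t (coordsGame i j s) (q i) (q j) 1 = δ * u := by
    simp [drift, hq]
  have hy4 : drift M t (coordsGame i j s) (q i) (q j) 4 = coordsGame i j s 4 := rfl
  have hsl : (M.alpha * Real.exp (-M.rho) + M.beta) * M.lam * (q i + q j)
      - (1 - Real.exp (-M.rho)) * s.residual + (M.aI t - M.bI t * s.env)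
      = slip M t (coordsGame i j s) (q i) (q j) := by
    simp [slip, coordsGame]
  -- The next remaining volume of trader `j` is `δ * u`, which absorbs the risk aversion `δ⁻¹`.
  have hcancel : ∀ z : ℝ, δ⁻¹ * (δ * u * z) = u * z := fun z => by field_simp
  rw [hu, hsl, logMoment, exponentJ, hpol, he, hy4, ← hq]
  simp only [Coeffs.exponent, hy1, hcancel]
  rw [show (1 : ℝ) - 2 * (M.sigI t ^ 2 * -D.K δ envDir)
      = 1 + 2 * (M.sigI t ^ 2 * D.K δ envDir) by ring]
  have hlam : δ⁻¹ * (M.lam * (q i + q j) * q j)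
      = δ⁻¹ * (M.lam * (q i + coordsGame i j s 1) * coordsGame i j s 1)
        - M.lam * (q i + q j) * u - M.lam * coordsGame i j s 1 * u := by
    rw [hq]
    field_simp
    ring
  rw [hlam]
  ring

variable [IsProbabilityMeasure P]

theorem hasExponent_game (hξ : IsMarketNoise M P ξ) (hij : i ≠ j) (hγ : 0 < γ) (hδ : δ ≠ 0)
    (hs : ∀ t ∈ Set.Ico 1 M.T, StageSolvable M γ δ t) {π : Fin 2 → Strategy (Fin 2)}
    {t : ℕ} (ht : t ∈ Set.Icc 1 M.T) (hπ : FollowsGame M γ δ i j π t) :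
    HasExponent M P ξ γ i π t (coordsGame i j) ((coeffs M γ t).J δ) ∧
      HasExponent M P ξ δ⁻¹ j π t (coordsGame i j) ((coeffs M γ t).exponent δ) := by
  obtain ⟨h1, h2⟩ := ht
  induction h2 using Nat.decreasingInduction with
  | self =>
    constructor <;> intro s <;> obtain ⟨hqi, hqj⟩ := hπ M.T le_rfl le_rfl s <;>
      rw [coeffs_final] at hqi hqj ⊢ <;> rw [cost_step hξ _ _ _ ⟨h1, le_rfl⟩]
    · refine (stageCost_final γ i π s (orders π M.T s)).trans ?_
      rw [if_pos (by rw [hqi]; rfl), sum_fin_two_of_ne hij]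
      congr 2
      simp [hqi, hqj, Coeffs.final, coordsGame]
    · refine (stageCost_final δ⁻¹ j π s (orders π M.T s)).trans ?_
      rw [if_pos (by rw [hqj]; simp [Coeffs.final, coordsGame]), sum_fin_two_of_ne hij]
      congr 2
      simp [hqi, hqj, Coeffs.final, Coeffs.exponent, coordsGame]
      exact Or.inl (by ring)
  | of_succ k hk ih =>
    obtain ⟨hI, hJ⟩ := ih (fun u hu => hπ u (by omega)) (by omega)
    have hsk := hs k ⟨h1, hk⟩
    constructor <;> intro s <;> obtain ⟨hqi, hqj⟩ := hπ k le_rfl hk.le s <;>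
      rw [cost_step hξ _ _ _ ⟨h1, hk.le⟩]
    · refine (stageCost_gameI hij hγ h1 hk hsk hI s _).trans ?_
      rw [hqi, hqj, coeffs_prev M γ hk]
      rfl
    · refine (stageCost_gameJ hij hγ hδ h1 hk hsk hJ s _ _ hqj).trans ?_
      rw [hqi, Coeffs.exponent, coeffs_prev M γ hk]
      congr 2
      simp only [Coeffs.prev]
      field_simp
      ring

theorem game_isMin_iff (hξ : IsMarketNoise M P ξ) (hij : i ≠ j) (hγ : 0 < γ) (hδ : δ ≠ 0)
    (hs : ∀ t ∈ Set.Ico 1 M.T, StageSolvable M γ δ t) {π : Fin 2 → Strategy (Fin 2)}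
    {t : ℕ} (ht : t ∈ Set.Icc 1 M.T) (hπ : FollowsGame M γ δ i j π (t + 1))
    (s : State (Fin 2)) (q : Fin 2 → ℝ) :
    ((∀ q', stageCost M P ξ γ i π t s q ≤ stageCost M P ξ γ i π t s (Function.update q i q')) ∧
      (∀ q', stageCost M P ξ δ⁻¹ j π t s q
        ≤ stageCost M P ξ δ⁻¹ j π t s (Function.update q j q')))
      ↔ q i = (coeffs M γ t).q δ (coordsGame i j s) ∧
        q j = coordsGame i j s 1 - δ * (coeffs M γ t).u δ (coordsGame i j s) := by
  rcases ht.2.eq_or_lt with rfl | hlt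
  · rw [stageCost_final_isMin_iff, stageCost_final_isMin_iff, coeffs_final]
    simp [Coeffs.final, coordsGame]
  · obtain ⟨hI, hJ⟩ := hasExponent_game hξ hij hγ hδ hs ⟨by omega, hlt⟩ hπ
    have hst := hs t ⟨ht.1, hlt⟩
    -- For `δ ≠ 0` the orders of trader `j` correspond bijectively to the rescaled leftovers.
    obtain ⟨u, hu⟩ : ∃ u, q j = coordsGame i j s 1 - δ * u :=
      ⟨δ⁻¹ * (coordsGame i j s 1 - q j), by field_simp; ring⟩
    have hu_iff : q j = coordsGame i j s 1 - δ * (coeffs M γ t).u δ (coordsGame i j s)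
        ↔ u = (coeffs M γ t).u δ (coordsGame i j s) := by
      rw [hu, sub_right_inj, mul_right_inj' hδ]
    rw [hu_iff, ← hst.2.2, ← hu]
    refine and_congr ?_ ?_
    · simp only [stageCost_gameI hij hγ ht.1 hlt hst hI, ofReal_exp_le_iff, Function.update_self,
        Function.update_of_ne hij.symm]
    · have hdev : ∀ u', stageCost M P ξ δ⁻¹ j π t s q ≤ stageCost M P ξ δ⁻¹ j π t s
            (Function.update q j (coordsGame i j s 1 - δ * u'))
          ↔ exponentJ M t δ ((coeffs M γ (t + 1)).N δ) ((coeffs M γ (t + 1)).K δ)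
            (coordsGame i j s) (q i) u - M.lam * coordsGame i j s 1 * u
          ≤ exponentJ M t δ ((coeffs M γ (t + 1)).N δ) ((coeffs M γ (t + 1)).K δ)
            (coordsGame i j s) (q i) u' - M.lam * coordsGame i j s 1 * u' := by
        intro u'
        rw [stageCost_gameJ hij hγ hδ ht.1 hlt hst hJ s q u hu,
          stageCost_gameJ hij hγ hδ ht.1 hlt hst hJ s _ u' (Function.update_self ..),
          ofReal_exp_le_iff, Function.update_of_ne hij, add_le_add_iff_left]
      refine ⟨fun h u' => (hdev u').1 (h _), fun h q' => ?_⟩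
      have h' := (hdev (δ⁻¹ * (coordsGame i j s 1 - q'))).2 (h _)
      rwa [show coordsGame i j s 1 - δ * (δ⁻¹ * (coordsGame i j s 1 - q')) = q' by
        field_simp; ring] at h'

/-- Uniqueness of the stage equilibrium, applied backwards in time, determines both traders' rules
at every state. -/
theorem followsGame_of_equilibrium (hξ : IsMarketNoise M P ξ) (hij : i ≠ j) (hγ : 0 < γ)
    (hδ : δ ≠ 0) (hs : ∀ t ∈ Set.Ico 1 M.T, StageSolvable M γ δ t)
    {π : Fin 2 → Strategy (Fin 2)}
    (hπ : IsMarkovPerfectEquilibrium M P ξ (Function.update (fun _ => γ) j δ⁻¹) π) :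
    FollowsGame M γ δ i j π 1 := by
  suffices H : ∀ t ≤ M.T + 1, 1 ≤ t → FollowsGame M γ δ i j π t from H 1 (by omega) le_rfl
  intro t ht
  induction ht using Nat.decreasingInduction with
  | self => intro _ u hu hu'; omega
  | of_succ k hk ih =>
    intro h1 u hu hu' s
    rcases hu.eq_or_lt with rfl | hlt
    · have hmem : k ∈ Set.Icc 1 M.T := ⟨h1, hu'⟩
      refine (game_isMin_iff hξ hij hγ hδ hs hmem (ih (by omega)) s _).1
        ⟨stageCost_le_of_optimal hξ hmem s fun σ => ?_,
          stageCost_le_of_optimal hξ hmem s fun σ => ?_⟩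
      · have h := (value_le_value_iff _ _ _ _ _ _).1 (hπ i k hmem s σ)
        rwa [Function.update_of_ne hij] at h
      · have h := (value_le_value_iff _ _ _ _ _ _).1 (hπ j k hmem s σ)
        rwa [Function.update_self] at h
    · exact ih (by omega) u hlt hu' s

theorem measurable_coordsGame (i j : Fin 2) : Measurable (coordsGame i j) := by
  unfold coordsGame State.remaining State.residual State.env
  refine measurable_pi_iff.2 fun l => ?_
  fin_cases l <;> simp <;> fun_prop

theorem exists_equilibrium (hξ : IsMarketNoise M P ξ) (hij : i ≠ j) (hγ : 0 < γ)
    (hδ : δ ≠ 0) (hs : ∀ t ∈ Set.Ico 1 M.T, StageSolvable M γ δ t) :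
    ∃ π, IsMarkovPerfectEquilibrium M P ξ (Function.update (fun _ => γ) j δ⁻¹) π := by
  classical
  let π : Fin 2 → Strategy (Fin 2) := fun k =>
    ⟨fun t s => if t ∈ Set.Icc 1 M.T then
      (if k = i then (coeffs M γ t).q δ (coordsGame i j s)
        else coordsGame i j s 1 - δ * (coeffs M γ t).u δ (coordsGame i j s)) else 0, fun t => by
      by_cases ht : t ∈ Set.Icc 1 M.T
      · have hD := coeffs_regular M hγ ht
        have hX := measurable_coordsGame i j
        by_cases hk : k = i
        · simp only [if_pos ht, if_pos hk]
          exact (hD.q.continuous δ).measurable.comp hX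
        · simp only [if_pos ht, if_neg hk]
          exact ((measurable_pi_apply 1).comp hX).sub
            (((hD.u.continuous δ).measurable.comp hX).const_mul δ)
      · simp only [if_neg ht, measurable_const]⟩
  have hπ : FollowsGame M γ δ i j π 1 := fun u h1 h2 s => by
    simp [π, orders, h1, h2, hij.symm]
  have hstage := fun t (ht : t ∈ Set.Icc 1 M.T) s =>
    (game_isMin_iff hξ hij hγ hδ hs ht (fun u hu => hπ u (by omega)) s _).2 (hπ t ht.1 ht.2 s)
  refine ⟨π, fun k t ht s σ => (value_le_value_iff _ _ _ _ _ _).2 ?_⟩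
  obtain rfl | rfl : k = i ∨ k = j := by omega
  · rw [Function.update_of_ne hij]
    exact optimal_of_stageCost_le hξ (fun t ht s => (hstage t ht s).1) ht s σ
  · rw [Function.update_self]
    exact optimal_of_stageCost_le hξ (fun t ht s => (hstage t ht s).2) ht s σ

theorem coordsGame_eq_alone (s : State (Fin 2)) (hs : s.remaining j = 0) :
    coordsGame i j s = coordsSingle (State.alone i s) := by
  simp [coordsGame, coordsSingle, State.alone, hs]

theorem tendsto_drift (M : Market) (t : ℕ) {α : Type*} {f : Filter α} {x : α → Fin 5 → ℝ}
    {q p : α → ℝ} {x₀ : Fin 5 → ℝ} {q₀ p₀ : ℝ} (hx : Tendsto x f (𝓝 x₀))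
    (hq : Tendsto q f (𝓝 q₀)) (hp : Tendsto p f (𝓝 p₀)) :
    Tendsto (fun a => drift M t (x a) (q a) (p a)) f (𝓝 (drift M t x₀ q₀ p₀)) := by
  have hc : Continuous fun z : (Fin 5 → ℝ) × ℝ × ℝ => drift M t z.1 z.2.1 z.2.2 := by
    unfold drift
    refine continuous_pi fun l => ?_
    fin_cases l <;> simp <;> fun_prop
  exact (hc.tendsto (x₀, q₀, p₀)).comp (hx.prodMk_nhds (hq.prodMk_nhds hp))

/-- The homogenized state of the game converges to that of the single-trader market. -/
theorem tendsto_coordsGame_stateFrom (hij : i ≠ j) (hγ : 0 < γ) {α : Type*} {f : Filter α}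
    {d : α → ℝ} (hd : Tendsto d f (𝓝 0)) {π : α → Fin 2 → Strategy (Fin 2)}
    {πs : Unit → Strategy Unit} (hπ : ∀ᶠ a in f, FollowsGame M γ (d a) i j (π a) 1)
    (hπs : FollowsSingle M γ πs 1) (x : ℕ → ℝ × ℝ) (s : State (Fin 2)) (hs : s.remaining j = 0)
    {n : ℕ} (hn : n ≤ M.T) :
    Tendsto (fun a => coordsGame i j (stateFrom M (π a) x 1 s n)) f
      (𝓝 (coordsSingle (stateFrom M πs x 1 (State.alone i s) n))) := by
  induction n with
  | zero =>
    simp only [stateFrom, coordsGame_eq_alone s hs]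
    exact tendsto_const_nhds
  | succ n ih =>
    have hX := ih (by omega)
    have hD := coeffs_regular M hγ (t := 1 + n) ⟨by omega, by omega⟩
    simp only [stateFrom, coordsGame_step hij, coordsSingle_step]
    refine Tendsto.add ?_ tendsto_const_nhds
    rw [hπs (1 + n) (by omega) (by omega)]
    refine tendsto_drift M (1 + n) hX ?_ ?_
    · refine (hD.q.tendsto hd hX).congr' ?_
      filter_upwards [hπ] with a ha
      exact (ha (1 + n) (by omega) (by omega) _).1.symm
    · have h1 := (((continuous_apply (1 : Fin 5)).tendsto _).comp hX).sub
        (hd.mul (hD.u.tendsto hd hX))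
      simp only [coordsSingle, Matrix.cons_val_one, Matrix.cons_val_zero, zero_mul, sub_zero] at h1
      refine h1.congr' ?_
      filter_upwards [hπ] with a ha
      exact (ha (1 + n) (by omega) (by omega) _).2.symm

end Game

end ExecutionGame

end

/-! ### The main theorem, with `δ = g⁻¹`. -/

open ExecutionGame in
theorem proposition4p2 {Ω : Type*} [MeasurableSpace Ω] (P : Measure Ω) [IsProbabilityMeasure P]
    (M : Market) (ξ : ℕ → Ω → ℝ × ℝ) (hξ : IsMarketNoise M P ξ)
    (i j : Fin 2) (hij : i ≠ j) (γi : ℝ) (hγi : 0 < γi) :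
    -- the single-trader problem has an optimal execution strategy
    (∃ πs : Strategy Unit, IsOptimalExecution M P ξ γi πs) ∧
    -- for large risk aversion `g` of trader `j` the game has a Markov perfect equilibrium
    (∀ᶠ g : ℝ in atTop, ∃ π : Fin 2 → Strategy (Fin 2),
      IsMarkovPerfectEquilibrium M P ξ (Function.update (fun _ => γi) j g) π) ∧
    -- any equilibria converge, for trader `i`, to any optimal execution strategy
    (∀ (πs : Strategy Unit) (π : ℝ → Fin 2 → Strategy (Fin 2)),
      IsOptimalExecution M P ξ γi πs →
      (∀ᶠ g : ℝ in atTop,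
        IsMarkovPerfectEquilibrium M P ξ (Function.update (fun _ => γi) j g) (π g)) →
      -- convergence of the executed volumes along every noise path
      (∀ (W : Fin 2 → ℝ) (p : ℝ) (Q : Fin 2 → ℝ), Q j = 0 →
        ∀ t ∈ Set.Icc 1 M.T, ∀ a : Ω,
          Tendsto
            (fun g : ℝ => executed M (π g) (fun u => ξ u a) (initialState W p Q) t i) atTop
            (𝓝 (executed M (fun _ => πs) (fun u => ξ u a)
              (State.alone i (initialState W p Q)) t ()))) ∧
      -- convergence of the decision rules at the states where trader `j` has nothing to execute
      (∀ t ∈ Set.Icc 1 M.T, ∀ s : State (Fin 2), s.remaining j = 0 →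
        Tendsto (fun g : ℝ => (π g i).1 t s) atTop (𝓝 (πs.1 t (State.alone i s))))) := by
  have hd : Tendsto (fun g : ℝ => g⁻¹) atTop (𝓝 0) := tendsto_inv_atTop_zero
  have hsolv := hd.eventually (eventually_stageSolvable M hγi)
  refine ⟨exists_optimalExecution hξ hγi, ?_, ?_⟩
  · filter_upwards [hsolv, eventually_gt_atTop 0] with g hg hg0
    simpa only [inv_inv] using exists_equilibrium hξ hij hγi (inv_pos.2 hg0).ne' hg
  · intro πs π hπs hπ
    have hsingle := followsSingle_of_optimal hξ hγi hπs
    have hgame : ∀ᶠ g in atTop, FollowsGame M γi g⁻¹ i j (π g) 1 := by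
      filter_upwards [hsolv, eventually_gt_atTop 0, hπ] with g hg hg0 hπg
      refine followsGame_of_equilibrium hξ hij hγi (inv_pos.2 hg0).ne' hg ?_
      rwa [inv_inv]
    refine ⟨fun W p Q hQ t ht a => ?_, fun t ht s hs => ?_⟩
    · have hX := tendsto_coordsGame_stateFrom hij hγi hd hgame hsingle (fun u => ξ u a)
        (initialState W p Q) hQ (n := t - 1) (by have := ht.2; omega)
      rw [executed, hsingle t ht.1 ht.2]
      refine ((coeffs_regular M hγi ht).q.tendsto hd hX).congr' ?_
      filter_upwards [hgame] with g hg
      exact (hg t ht.1 ht.2 _).1.symm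
    · have h := hsingle t ht.1 ht.2 (State.alone i s)
      rw [show πs.1 t (State.alone i s) = _ from h, ← coordsGame_eq_alone s hs]
      refine ((coeffs_regular M hγi ht).q.tendsto hd tendsto_const_nhds).congr' ?_
      filter_upwards [hgame] with g hg
      exact (hg t ht.1 ht.2 s).1.symm
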